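/- Let $n\ge 3$ and let $B_1$ be the open unit ball of $\mathbb R^n$. For $\alpha>0$, a function $\eta:\mathbb R\to[0,\infty)$ with $\lim_{r\to0^+}\eta(r)=0$ and a measurable function $V$ on $B_1$ (scalar or vector valued), write $V\in K^\alpha_\eta(B_1)$ if $$\sup_{x\in B_1}\int_{B_1\cap B_r(x)}\frac{|V(y)|}{|x-y|^{n-\alpha}}\,dy\le\eta(r)\quad\text{for all } r>0,\qquad\text{and put}\quad \|V\|_{K^\alpha(B_1)}=\sup_{x\in B_1}\int_{B_1}\frac{|V(y)|}{|x-y|^{n-\alpha}}\,dy .$$ For $\alpha=2$ (the Kato class) write $K_\eta(B_1)$ and $\|V\|_{K(B_1)}$. Let $G$ be the Green function of $-\Delta$ in $B_1$ with zero Dirichlet boundary values, that is, $G(x,y)=\Phi(y-x)-h_x(y)$ for $x\in B_1$, $y\in\overline B_1$, $y\ne x$, where $\Phi(z)=\frac{|z|^{2-n}}{n(n-2)|B_1|}$ and $h_x\in C(\overline B_1)$ is harmonic in $B_1$ with $h_x=\Phi(\cdot-x)$ on $\partial B_1$. (This function exists.) There is a constant $C$ depending only on $n$ such that the following holds. Let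 $g\in K_{\eta_g}(B_1)$ and $\vec f\in K^1_{\eta_f}(B_1)\cap L^2(B_1)^n$. Then the problem $$-\Delta u=-\operatorname{div}\vec f+g\ \text{ in } B_1,\qquad u=0\ \text{ on }\partial B_1,$$ has a unique solution $u\in W_0^{1,2}(B_1)\cap C(\overline B_1)$, in the weak sense that, for every $\varphi\in W_0^{1,2}(B_1)$, the function $\vec f\cdot\nabla\varphi+g\varphi$ is integrable on $B_1$ and $$\int_{B_1}\nabla u\cdot\nabla\varphi\,dx=\int_{B_1}\big(\vec f\cdot\nabla\varphi+g\varphi\big)\,dx .$$ The solution is represented by $$u(x)=\int_{B_1}\big(\nabla_yG(x,y)\cdot\vec f(y)+G(x,y)g(y)\big)\,dy\quad(x\in B_1),\qquad u(x)=0\quad(x\in\partial B_1),$$ where the integrand is integrable for every $x\in B_1$, and it satisfies $$\|u\|_{L^\infty(B_1)}+\|\nabla u\|_{L^2(B_1)}\le C\left(\|\vec f\|_{L^2(B_1)}+\|g\|_{L^1(B_1)}+\|\vec f\|_{K^1(B_1)}+\|g\|_{K(B_1)}\right).$$ -/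

import Mathlib

open MeasureTheory Set Filter Topology
open scoped ENNReal NNReal ContDiff

noncomputable section

namespace KatoDirichlet

/-- Euclidean space `ℝⁿ`. -/
abbrev Rn (n : ℕ) : Type := EuclideanSpace ℝ (Fin n)

/-- The open unit ball `B₁` of `ℝⁿ`. -/
def unitBall (n : ℕ) : Set (Rn n) := Metric.ball 0 1

/-- The norm `‖V‖_{K^α(Ω)} = sup_{x ∈ Ω} ∫_Ω |V(y)| / |x - y|^{n - α} dy`, as an extended number
(`V` may be scalar or vector valued). The classical Kato norm is the case `α = 2`. -/
def katoNorm {n : ℕ} {F : Type*} [NormedAddCommGroup F] (α : ℝ) (Ω : Set (Rn n))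
    (V : Rn n → F) : ℝ≥0∞ :=
  ⨆ x ∈ Ω, ∫⁻ y in Ω, ‖V y‖ₑ / ‖x - y‖ₑ ^ ((n : ℝ) - α)

/-- `V ∈ K^α_η(Ω)`: `η(r) → 0` as `r → 0⁺` and
`sup_{x ∈ Ω} ∫_{Ω ∩ B_r(x)} |V(y)| / |x - y|^{n - α} dy ≤ η(r)` for all `r > 0`.
The classical Kato class is the case `α = 2`. -/
structure MemKato {n : ℕ} {F : Type*} [NormedAddCommGroup F] (α : ℝ) (η : ℝ → ℝ≥0)
    (Ω : Set (Rn n)) (V : Rn n → F) : Prop where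
  aestronglyMeasurable : AEStronglyMeasurable V (volume.restrict Ω)
  tendsto_modulus : Tendsto η (𝓝[>] 0) (𝓝 0)
  bound : ∀ r : ℝ, 0 < r →
    (⨆ x ∈ Ω, ∫⁻ y in Ω ∩ Metric.ball x r, ‖V y‖ₑ / ‖x - y‖ₑ ^ ((n : ℝ) - α)) ≤ (η r : ℝ≥0∞)

/-- `φ ∈ C_c^∞(Ω)`. -/
structure IsTestFunction {n : ℕ} (Ω : Set (Rn n)) (φ : Rn n → ℝ) : Prop where
  contDiff : ContDiff ℝ ∞ φ
  hasCompactSupport : HasCompactSupport φ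
  tsupport_subset : tsupport φ ⊆ Ω

/-- `u ∈ W^{1,2}(Ω)` with weak gradient `Du`. -/
structure IsW12 {n : ℕ} (Ω : Set (Rn n)) (u : Rn n → ℝ) (Du : Rn n → Rn n) : Prop where
  memLp : MemLp u 2 (volume.restrict Ω)
  memLp_grad : MemLp Du 2 (volume.restrict Ω)
  weak_grad : ∀ φ : Rn n → ℝ, IsTestFunction Ω φ →
    ∫ y in Ω, u y • gradient φ y = - ∫ y in Ω, φ y • Du y

/-- `u ∈ W_0^{1,2}(Ω)` with weak gradient `Du`: `u` belongs to the closure of `C_c^∞(Ω)` in the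
norm of `W^{1,2}(Ω)`. -/
structure IsW012 {n : ℕ} (Ω : Set (Rn n)) (u : Rn n → ℝ) (Du : Rn n → Rn n) : Prop where
  isW12 : IsW12 Ω u Du
  approx : ∃ φ : ℕ → Rn n → ℝ, (∀ k, IsTestFunction Ω (φ k)) ∧
    Tendsto (fun k => eLpNorm (fun y => φ k y - u y) 2 (volume.restrict Ω)) atTop (𝓝 0) ∧
    Tendsto (fun k => eLpNorm (fun y => gradient (φ k) y - Du y) 2 (volume.restrict Ω))
      atTop (𝓝 0)

/-- `u ∈ W^{1,2}(Ω)`, with weak gradient `Du`, is a weak solution of `-Δu = -div f + g` in `Ω`: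
`∫_Ω ∇u · ∇φ = ∫_Ω (f · ∇φ + g φ)` for all `φ ∈ W_0^{1,2}(Ω)`, the integrand on the right being
integrable. -/
structure IsWeakSolution {n : ℕ} (Ω : Set (Rn n)) (f : Rn n → Rn n) (g : Rn n → ℝ)
    (u : Rn n → ℝ) (Du : Rn n → Rn n) : Prop where
  isW12 : IsW12 Ω u Du
  integrable_rhs : ∀ (φ : Rn n → ℝ) (Dφ : Rn n → Rn n), IsW012 Ω φ Dφ →
    IntegrableOn (fun y => inner ℝ (f y) (Dφ y) + g y * φ y) Ω
  weak_eq : ∀ (φ : Rn n → ℝ) (Dφ : Rn n → Rn n), IsW012 Ω φ Dφ →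
    ∫ y in Ω, inner ℝ (Du y) (Dφ y) = ∫ y in Ω, (inner ℝ (f y) (Dφ y) + g y * φ y)

/-- `u ∈ W_0^{1,2}(Ω) ∩ C(Ω̄)`, with weak gradient `Du`, solves `-Δu = -div f + g` in `Ω`, `u = 0` on
`∂Ω`; the boundary condition is the membership in `W_0^{1,2}(Ω)`. -/
structure IsDirichletSolution {n : ℕ} (Ω : Set (Rn n)) (f : Rn n → Rn n) (g : Rn n → ℝ)
    (u : Rn n → ℝ) (Du : Rn n → Rn n) : Prop where
  isW012 : IsW012 Ω u Du
  continuousOn : ContinuousOn u (closure Ω)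
  isWeakSolution : IsWeakSolution Ω f g u Du

/-- The fundamental solution of `-Δ` in `ℝⁿ`, `n ≥ 3`: `Φ(z) = |z|^{2 - n} / (n (n - 2) |B₁|)`. -/
def fundamentalSolution (n : ℕ) (z : Rn n) : ℝ :=
  ‖z‖ ^ (2 - (n : ℝ)) / ((n : ℝ) * ((n : ℝ) - 2) * volume.real (unitBall n))

/-- `G` is the Green function of `-Δ` in `Ω` with zero Dirichlet boundary values:
for every pole `x ∈ Ω`, `G(x, ·) = Φ(· - x) - h`, where the corrector `h` is continuous on `Ω̄`,
harmonic in `Ω`, and equal to `Φ(· - x)` on `∂Ω`. -/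
def IsGreenFunction {n : ℕ} (Ω : Set (Rn n)) (G : Rn n → Rn n → ℝ) : Prop :=
  ∀ x ∈ Ω, ∃ h : Rn n → ℝ,
    ContinuousOn h (closure Ω) ∧
    InnerProductSpace.HarmonicOnNhd h Ω ∧
    (∀ y ∈ frontier Ω, h y = fundamentalSolution n (y - x)) ∧
    ∀ y ∈ closure Ω, y ≠ x → G x y = fundamentalSolution n (y - x) - h y

/-- The integrand `∇_y G(x, y) · f(y) + G(x, y) g(y)` of the Green representation. -/
def greenIntegrand {n : ℕ} (G : Rn n → Rn n → ℝ) (f : Rn n → Rn n) (g : Rn n → ℝ)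
    (x y : Rn n) : ℝ :=
  inner ℝ (gradient (fun z => G x z) y) (f y) + G x y * g y

end KatoDirichlet

end

/-!
The Green function of the unit ball is explicit,
`G(x, y) = c_n (|y - x|^{2 - n} - (|x|² |y|² - 2 ⟪x, y⟫ + 1)^{1 - n/2})`. Both terms are powers of
quadratic polynomials `a |y|² - 2 ⟪x, y⟫ + b` in `y`; adding `t > 0` to both polynomials gives a
kernel `green t x` which is smooth on the whole space, still vanishes when `|x| = 1` or `|y| = 1`,
satisfies `|green t| ≲ |x - y|^{2 - n}` and `|∇ green t| ≲ |x - y|^{1 - n}` uniformly in `t`, and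
whose Laplacian (`laplacian_green`) is an approximation of `-δ_x`. Everything about `G = green 0` is
proved for `t > 0` and then carried to the limit `t → 0` by dominated convergence.

* Green's identity for `green t x` gives the reproducing formula `φ(x) = ∫ ∇_y G(x, y) · ∇φ(y) dy`
  for test functions (`IsTestFunction.eq_integral`). The operator
  `greenPot D (x) = ∫ ∇_y G(x, y) · D(y) dy` is bounded on `L²(B₁)` by a Schur test, so that
  `u = greenPot ∇u` almost everywhere for all `u ∈ W₀^{1,2}(B₁)` (`IsW012.ae_eq_greenPot`). This
  replaces the Poincaré inequality, and it gives uniqueness, since two solutions have the same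
  gradient.
* Let `P` be the orthogonal projection of `L²` vector fields onto the closure of the gradients of
  test functions. The operator `greenPot` vanishes on the range of `1 - P`, because `green t x`
  belongs to `W₀^{1,2}(B₁)` (`isW012_green`), so `greenPot f = greenPot (P f)` is a function of
  `W₀^{1,2}(B₁)` with gradient `P f`. It solves `-Δu = -div f` (`exists_isW012_greenPot`).
* A scalar `g` in the Kato class is reduced to this case by its dual field
  `F(y) = ∫ g(z) ∇_y G(z, y) dz`. The composition of two Riesz kernels
  `∫ |x - y|^{1 - n} |y - z|^{1 - n} dy ≲ |x - z|^{2 - n}` yields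
  `‖F‖²_{L²} ≲ ‖g‖_{L¹} ‖g‖_K ≤ ‖g‖_K²`. By Fubini's theorem and the reproducing formula,
  `∫ g φ = ∫ F · ∇φ` for `φ ∈ W₀^{1,2}(B₁)` (`IsW012.integrable_mul_and_integral_eq`); taking
  `φ = green t x` shows that `greenPot F` is the Green potential of `g` almost everywhere
  (`greenPot_dualField_ae`). Hence `greenPot (f + F)` agrees almost everywhere with the Green
  representation `greenSolution f g`.
* The Green representation is bounded by the Kato norms, and it is continuous up to the boundary as
  a uniform limit of potentials with kernels cut off near the diagonal; the error of the cutoff is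
  the Kato modulus (`continuousOn_integral_of_kato`).
-/

noncomputable section

namespace KatoDirichlet

/-! ### Powers of quadratic polynomials -/

section Quadratic

variable {E : Type*} [NormedAddCommGroup E] [InnerProductSpace ℝ E]

/-- The quadratic polynomial `a |y|² - 2 ⟪x, y⟫ + b` in `y`. -/
def quad (a b : ℝ) (x y : E) : ℝ := a * ‖y‖ ^ 2 - 2 * inner ℝ x y + b

lemma continuous_quad (a b : ℝ) (x : E) : Continuous (quad a b x) := by
  unfold quad; fun_prop

lemma contDiff_quad (a b : ℝ) (x : E) {k : WithTop ℕ∞} : ContDiff ℝ k (quad a b x) :=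
  ((contDiff_const.mul (contDiff_norm_sq ℝ)).sub
    (contDiff_const.mul (contDiff_const.inner ℝ contDiff_id))).add contDiff_const

lemma norm_smul_sub_sq (a b : ℝ) (x y : E) :
    ‖a • y - x‖ ^ 2 = a * quad a b x y + (‖x‖ ^ 2 - a * b) := by
  rw [norm_sub_sq_real, norm_smul, real_inner_smul_left, real_inner_comm, quad, mul_pow,
    Real.norm_eq_abs, sq_abs]
  ring

lemma hasFDerivAt_quad (a b : ℝ) (x y : E) :
    HasFDerivAt (quad a b x) ((2 : ℝ) • innerSL ℝ (a • y - x)) y := by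
  unfold quad
  have h1 : HasFDerivAt (fun y : E => ‖y‖ ^ 2) (2 • innerSL ℝ y) y :=
    (hasStrictFDerivAt_norm_sq y).hasFDerivAt
  have h2 : HasFDerivAt (fun y : E => inner ℝ x y) (innerSL ℝ x) y :=
    (innerSL ℝ x).hasFDerivAt
  refine (((h1.const_mul a).sub (h2.const_mul 2)).add_const b).congr_fderiv ?_
  ext z
  simp
  ring

lemma hasFDerivAt_quad_rpow {a b : ℝ} {x y : E} (h : 0 < quad a b x y) (p : ℝ) :
    HasFDerivAt (fun y => quad a b x y ^ p)
      ((2 * p * quad a b x y ^ (p - 1)) • innerSL ℝ (a • y - x)) y := by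
  refine ((hasFDerivAt_quad a b x y).rpow_const (p := p) (Or.inl h.ne')).congr_fderiv ?_
  rw [smul_smul]
  congr 1
  ring

lemma contDiffAt_quad_rpow {a b : ℝ} {x y : E} (h : 0 < quad a b x y) (p : ℝ)
    {k : WithTop ℕ∞} : ContDiffAt ℝ k (fun y => quad a b x y ^ p) y :=
  (contDiff_quad a b x).contDiffAt.rpow_const_of_ne h.ne'

lemma fderiv_fderiv_quad_rpow {a b : ℝ} {x y : E} (h : 0 < quad a b x y) (p : ℝ) (e : E) :
    fderiv ℝ (fderiv ℝ (fun y => quad a b x y ^ p)) y e e =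
      2 * p * quad a b x y ^ (p - 1) * (a * ‖e‖ ^ 2) +
        4 * p * (p - 1) * quad a b x y ^ (p - 2) * inner ℝ (a • y - x) e ^ 2 := by
  have hev : fderiv ℝ (fun y => quad a b x y ^ p) =ᶠ[𝓝 y]
      fun y => (2 * p * quad a b x y ^ (p - 1)) • innerSL ℝ (a • y - x) := by
    filter_upwards [(continuous_quad a b x).continuousAt.eventually (lt_mem_nhds h)] with z hz
    exact (hasFDerivAt_quad_rpow hz p).fderiv
  rw [hev.fderiv_eq]
  have h1 := (hasFDerivAt_quad_rpow h (p - 1)).const_mul (2 * p)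
  have h2 : HasFDerivAt (fun y : E => innerSL ℝ (a • y - x)) (a • innerSL ℝ) y := by
    have : HasFDerivAt (fun y : E => a • y - x) (a • ContinuousLinearMap.id ℝ E) y :=
      ((hasFDerivAt_id y).const_smul a).sub_const x
    refine ((innerSL ℝ).hasFDerivAt.comp y this).congr_fderiv ?_
    ext; simp
  have h3 := h1.smul h2
  rw [show fderiv ℝ (fun y => (2 * p * quad a b x y ^ (p - 1)) • innerSL ℝ (a • y - x)) y = _
    from h3.fderiv]
  simp only [add_apply, smul_apply,
    ContinuousLinearMap.smulRight_apply, smul_eq_mul]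
  erw [innerSL_apply_apply, innerSL_apply_apply]
  rw [real_inner_self_eq_norm_sq, show p - 1 - 1 = p - 2 by ring]
  ring

variable [FiniteDimensional ℝ E]

open InnerProductSpace in
/-- The Laplacian of `quad ^ (1 - N / 2)` in dimension `N`. It vanishes if `a b = |x|²`, which holds
for both parts of the Green function of the ball. -/
lemma laplacian_quad_rpow {a b : ℝ} {x y : E} (h : 0 < quad a b x y) :
    Laplacian.laplacian (fun y => quad a b x y ^ (1 - (Module.finrank ℝ E : ℝ) / 2)) y =
      (2 - (Module.finrank ℝ E : ℝ)) * Module.finrank ℝ E * (a * b - ‖x‖ ^ 2) *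
        quad a b x y ^ (-1 - (Module.finrank ℝ E : ℝ) / 2) := by
  set N : ℝ := (Module.finrank ℝ E : ℝ)
  rw [laplacian_eq_iteratedFDeriv_stdOrthonormalBasis]
  simp only [iteratedFDeriv_two_apply, Matrix.cons_val_zero, Matrix.cons_val_one]
  simp_rw [fderiv_fderiv_quad_rpow h]
  have hs : ∑ i, inner ℝ (a • y - x) (stdOrthonormalBasis ℝ E i) ^ 2 = ‖a • y - x‖ ^ 2 := by
    have := (stdOrthonormalBasis ℝ E).sum_sq_norm_inner_left (a • y - x)
    simpa using this
  simp only [Finset.sum_add_distrib, ← Finset.mul_sum]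
  rw [hs, norm_smul_sub_sq a b]
  simp only [OrthonormalBasis.norm_eq_one, Finset.sum_const, Finset.card_univ, Fintype.card_fin,
    nsmul_eq_mul]
  have h1 : quad a b x y ^ (1 - N / 2 - 1) =
      quad a b x y ^ (-1 - N / 2) * quad a b x y := by
    rw [← Real.rpow_add_one h.ne']; ring_nf
  rw [h1, show (1 - N / 2 - 2) = -1 - N / 2 by ring]
  rw [show ((Module.finrank ℝ E : ℕ) : ℝ) = N from rfl]
  ring

end Quadratic

/-! ### Green's first identity -/

section IntegrationByParts

variable {E : Type*} [NormedAddCommGroup E] [InnerProductSpace ℝ E] [FiniteDimensional ℝ E]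

lemma continuous_gradient {f : E → ℝ} (hf : ContDiff ℝ 1 f) : Continuous (gradient f) :=
  (InnerProductSpace.toDual ℝ E).symm.continuous.comp (hf.continuous_fderiv one_ne_zero)

lemma support_gradient_subset (f : E → ℝ) : Function.support (gradient f) ⊆ tsupport f := by
  intro y hy
  apply support_fderiv_subset ℝ
  intro h
  apply hy
  simp [gradient, h]

lemma hasCompactSupport_gradient {f : E → ℝ} (hf : HasCompactSupport f) :
    HasCompactSupport (gradient f) :=
  hf.mono' (support_gradient_subset f)

open InnerProductSpace in
variable [MeasurableSpace E] [BorelSpace E] in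
/-- Green's first identity on the whole space, one of the functions being compactly supported. -/
lemma integral_inner_gradient_gradient {L φ : E → ℝ} (hL : ContDiff ℝ 2 L) (hφ : ContDiff ℝ 1 φ)
    (hc : HasCompactSupport φ) (μ : Measure E) [μ.IsAddHaarMeasure] :
    ∫ y, inner ℝ (gradient L y) (gradient φ y) ∂μ =
      - ∫ y, Laplacian.laplacian L y * φ y ∂μ := by
  set v := stdOrthonormalBasis ℝ E
  have h1 (y : E) : inner ℝ (gradient L y) (gradient φ y) =
      ∑ i, fderiv ℝ L y (v i) * fderiv ℝ φ y (v i) := by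
    rw [← v.sum_inner_mul_inner]
    refine Finset.sum_congr rfl fun i _ => ?_
    simp
  have h2 (y : E) : Laplacian.laplacian L y * φ y =
      ∑ i, fderiv ℝ (fun z => fderiv ℝ L z (v i)) y (v i) * φ y := by
    rw [laplacian_eq_iteratedFDeriv_stdOrthonormalBasis, Finset.sum_mul]
    refine Finset.sum_congr rfl fun i _ => ?_
    simp only [iteratedFDeriv_two_apply, Matrix.cons_val_zero, Matrix.cons_val_one]
    rw [fderiv_clm_apply (hL.contDiffAt.fderiv_right (m := 1) (by norm_num) |>.differentiableAt
      (by norm_num)) (by fun_prop)]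
    simp [v]
  have hL1 (i) : ContDiff ℝ 1 (fun z => fderiv ℝ L z (v i)) :=
    (hL.fderiv_right (m := 1) (by norm_num)).clm_apply contDiff_const
  have hd (i) : Continuous fun y => fderiv ℝ φ y (v i) :=
    (hφ.continuous_fderiv one_ne_zero).clm_apply continuous_const
  have hdc (i) : HasCompactSupport fun y => fderiv ℝ φ y (v i) :=
    hc.fderiv_apply ℝ (v i)
  have hdd (i) : Continuous fun y => fderiv ℝ (fun z => fderiv ℝ L z (v i)) y (v i) :=
    ((hL1 i).continuous_fderiv one_ne_zero).clm_apply continuous_const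
  have i1 (i) : Integrable (fun y => fderiv ℝ L y (v i) * fderiv ℝ φ y (v i)) μ :=
    ((hL1 i).continuous.mul (hd i)).integrable_of_hasCompactSupport (hdc i).mul_left
  have i2 (i) : Integrable (fun y => fderiv ℝ (fun z => fderiv ℝ L z (v i)) y (v i) * φ y) μ :=
    ((hdd i).mul hφ.continuous).integrable_of_hasCompactSupport hc.mul_left
  have i3 (i) : Integrable (fun y => fderiv ℝ L y (v i) * φ y) μ :=
    ((hL1 i).continuous.mul hφ.continuous).integrable_of_hasCompactSupport hc.mul_left
  simp_rw [h1, h2]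
  rw [integral_finsetSum _ fun i _ => i1 i, integral_finsetSum _ fun i _ => i2 i,
    ← Finset.sum_neg_distrib]
  refine Finset.sum_congr rfl fun i _ => ?_
  exact integral_mul_fderiv_eq_neg_fderiv_mul_of_integrable (i2 i) (i1 i) (i3 i)
    (fun y _ => (hL1 i).differentiable (by norm_num) y)
    (fun y _ => hφ.differentiable (by norm_num) y)

end IntegrationByParts

variable {n : ℕ}

/-! ### The unit ball -/

lemma volume_real_unitBall_pos (n : ℕ) : 0 < volume.real (unitBall n) :=
  ENNReal.toReal_pos (Metric.measure_ball_pos volume _ one_pos).ne' measure_ball_lt_top.ne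

lemma mem_unitBall {x : Rn n} : x ∈ unitBall n ↔ ‖x‖ < 1 := mem_ball_zero_iff

lemma closure_unitBall (n : ℕ) : closure (unitBall n) = Metric.closedBall 0 1 :=
  closure_ball _ one_ne_zero

lemma mem_closure_unitBall {x : Rn n} : x ∈ closure (unitBall n) ↔ ‖x‖ ≤ 1 := by
  rw [closure_unitBall, mem_closedBall_zero_iff]

lemma mem_frontier_unitBall {x : Rn n} : x ∈ frontier (unitBall n) ↔ ‖x‖ = 1 := by
  rw [unitBall, frontier_ball _ one_ne_zero, mem_sphere_zero_iff_norm]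

lemma measurableSet_unitBall (n : ℕ) : MeasurableSet (unitBall n) := measurableSet_ball

lemma norm_le_one_of_mem {x : Rn n} (hx : x ∈ unitBall n) : ‖x‖ ≤ 1 := (mem_unitBall.1 hx).le

instance isFiniteMeasure_restrict_unitBall (n : ℕ) :
    IsFiniteMeasure ((volume : Measure (Rn n)).restrict (unitBall n)) :=
  ⟨by rw [Measure.restrict_apply_univ]; exact measure_ball_lt_top⟩

/-! ### The Riesz kernel -/

/-- The Riesz kernel `|x - y|^{-β}`, with the value `∞` on the diagonal if `β > 0`. -/
def riesz (β : ℝ) (x y : Rn n) : ℝ≥0∞ := (‖x - y‖ₑ ^ β)⁻¹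

lemma riesz_comm (β : ℝ) (x y : Rn n) : riesz β x y = riesz β y x := by
  rw [riesz, riesz, ← enorm_neg, neg_sub]

lemma riesz_of_ne (β : ℝ) {x y : Rn n} (h : y ≠ x) :
    riesz β x y = ENNReal.ofReal (‖y - x‖ ^ (-β)) := by
  have hp : 0 < ‖y - x‖ := norm_pos_iff.2 (sub_ne_zero.2 h)
  rw [riesz_comm, riesz, ← ENNReal.rpow_neg, ← ofReal_norm, ENNReal.ofReal_rpow_of_pos hp]

lemma riesz_self {β : ℝ} (h : 0 < β) (x : Rn n) : riesz β x x = ⊤ := by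
  simp [riesz, h]

lemma measurable_riesz (β : ℝ) : Measurable fun q : Rn n × Rn n => riesz β q.1 q.2 := by
  unfold riesz; fun_prop

@[fun_prop]
lemma measurable_riesz_right (β : ℝ) (x : Rn n) : Measurable fun y => riesz β x y := by
  unfold riesz; fun_prop

@[fun_prop]
lemma measurable_riesz_left (β : ℝ) (y : Rn n) : Measurable fun x => riesz β x y := by
  unfold riesz; fun_prop

/-! ### The Green function of the ball and its regularization -/

/-- The regularized Green function `c_n ((|y - x|² + t)^{1 - n/2} - (Q(x, y) + t)^{1 - n/2})` of the
unit ball, where `Q(x, y) = |x|² |y|² - 2 ⟪x, y⟫ + 1` and `c_n = 1 / (n (n - 2) |B₁|)`.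
It is smooth for `t > 0`, and it is the Green function for `t = 0`. -/
def green (t : ℝ) (x y : Rn n) : ℝ :=
  ((n : ℝ) * ((n : ℝ) - 2) * volume.real (unitBall n))⁻¹ *
    (quad 1 (‖x‖ ^ 2 + t) x y ^ (1 - (n : ℝ) / 2) -
      quad (‖x‖ ^ 2) (1 + t) x y ^ (1 - (n : ℝ) / 2))

/-- The gradient of `green t x`. -/
def greenGrad (t : ℝ) (x y : Rn n) : Rn n :=
  ((n : ℝ) * volume.real (unitBall n))⁻¹ •
    (quad (‖x‖ ^ 2) (1 + t) x y ^ (-((n : ℝ) / 2)) • (‖x‖ ^ 2 • y - x) -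
      quad 1 (‖x‖ ^ 2 + t) x y ^ (-((n : ℝ) / 2)) • (y - x))

lemma quad_one (t : ℝ) (x y : Rn n) : quad 1 (‖x‖ ^ 2 + t) x y = ‖y - x‖ ^ 2 + t := by
  rw [quad, norm_sub_sq_real, real_inner_comm]; ring

lemma quad_normSq (t : ℝ) (x y : Rn n) :
    quad (‖x‖ ^ 2) (1 + t) x y = ‖y - x‖ ^ 2 + (1 - ‖x‖ ^ 2) * (1 - ‖y‖ ^ 2) + t := by
  rw [quad, norm_sub_sq_real, real_inner_comm]; ring

/-- `Q(x, y) ≥ |y - x|²` in the ball, by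
`Q(x, y) = |y - x|² + (1 - |x|²) (1 - |y|²)`. -/
lemma le_quad_normSq {t : ℝ} {x y : Rn n} (hx : ‖x‖ ≤ 1) (hy : ‖y‖ ≤ 1) :
    ‖y - x‖ ^ 2 + t ≤ quad (‖x‖ ^ 2) (1 + t) x y := by
  have h1 : 0 ≤ 1 - ‖x‖ ^ 2 := by nlinarith [norm_nonneg x]
  have h2 : 0 ≤ 1 - ‖y‖ ^ 2 := by nlinarith [norm_nonneg y]
  rw [quad_normSq]
  nlinarith [mul_nonneg h1 h2]

lemma quad_normSq_pos {t : ℝ} (ht : 0 ≤ t) {x y : Rn n} (hx : ‖x‖ < 1) (hy : ‖y‖ ≤ 1) :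
    0 < quad (‖x‖ ^ 2) (1 + t) x y := by
  have h1 : inner ℝ x y ≤ ‖x‖ * ‖y‖ := real_inner_le_norm x y
  have h2 : ‖x‖ * ‖y‖ < 1 := by nlinarith [norm_nonneg x, norm_nonneg y]
  rw [quad]
  nlinarith [mul_pos (sub_pos.2 h2) (sub_pos.2 h2)]

lemma quad_normSq_pos_of_pos {t : ℝ} (ht : 0 < t) (x y : Rn n) :
    0 < quad (‖x‖ ^ 2) (1 + t) x y := by
  have h1 : inner ℝ x y ≤ ‖x‖ * ‖y‖ := real_inner_le_norm x y
  rw [quad]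
  nlinarith [sq_nonneg (‖x‖ * ‖y‖ - 1)]

lemma quad_one_pos {t : ℝ} (ht : 0 ≤ t) {x y : Rn n} (h : y ≠ x) :
    0 < quad 1 (‖x‖ ^ 2 + t) x y := by
  have hp : 0 < ‖y - x‖ := norm_pos_iff.2 (sub_ne_zero.2 h)
  rw [quad_one]; positivity

lemma quad_one_pos_of_pos {t : ℝ} (ht : 0 < t) (x y : Rn n) :
    0 < quad 1 (‖x‖ ^ 2 + t) x y := by
  rw [quad_one]; positivity

lemma hasGradientAt_green (hn : 3 ≤ n) {t : ℝ} {x y : Rn n} (h1 : 0 < quad 1 (‖x‖ ^ 2 + t) x y)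
    (h2 : 0 < quad (‖x‖ ^ 2) (1 + t) x y) : HasGradientAt (green t x) (greenGrad t x y) y := by
  have hn' : (3 : ℝ) ≤ n := by exact_mod_cast hn
  rw [hasGradientAt_iff_hasFDerivAt]
  refine (((hasFDerivAt_quad_rpow h1 (1 - (n : ℝ) / 2)).sub
    (hasFDerivAt_quad_rpow h2 (1 - (n : ℝ) / 2))).const_mul _).congr_fderiv ?_
  ext z
  have hv := volume_real_unitBall_pos n
  have h3 : (n : ℝ) - 2 ≠ 0 := by linarith
  have h4 : (n : ℝ) ≠ 0 := by linarith
  simp only [greenGrad, one_smul, smul_apply, sub_apply, smul_eq_mul,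
    InnerProductSpace.toDual_apply_apply, real_inner_smul_left, inner_sub_left, map_sub]
  erw [innerSL_apply_apply, innerSL_apply_apply, innerSL_apply_apply]
  rw [real_inner_smul_left, show 1 - (n : ℝ) / 2 - 1 = -((n : ℝ) / 2) by ring]
  field_simp
  ring

lemma contDiff_green {t : ℝ} (ht : 0 < t) (x : Rn n) {k : WithTop ℕ∞} :
    ContDiff ℝ k (green t x) := by
  rw [contDiff_iff_contDiffAt]
  intro y
  exact contDiffAt_const.mul ((contDiffAt_quad_rpow (quad_one_pos_of_pos ht x y) _).sub
    (contDiffAt_quad_rpow (quad_normSq_pos_of_pos ht x y) _))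

lemma gradient_green (hn : 3 ≤ n) {t : ℝ} (ht : 0 < t) (x : Rn n) :
    gradient (green t x) = greenGrad t x :=
  funext fun y => (hasGradientAt_green hn (quad_one_pos_of_pos ht x y)
    (quad_normSq_pos_of_pos ht x y)).gradient

lemma gradient_green_zero (hn : 3 ≤ n) {x y : Rn n} (hx : ‖x‖ < 1) (hy : ‖y‖ ≤ 1) (h : y ≠ x) :
    gradient (green 0 x) y = greenGrad 0 x y :=
  (hasGradientAt_green hn (quad_one_pos le_rfl h) (quad_normSq_pos le_rfl hx hy)).gradient

/-- The first term of the Laplacian is an approximation of `-δ_x` as `t → 0`, the second one tends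
to zero uniformly in the ball. -/
lemma laplacian_green (hn : 3 ≤ n) {t : ℝ} (ht : 0 < t) (x y : Rn n) :
    Laplacian.laplacian (green t x) y = - (volume.real (unitBall n))⁻¹ *
      (t * quad 1 (‖x‖ ^ 2 + t) x y ^ (-1 - (n : ℝ) / 2) -
        t * ‖x‖ ^ 2 * quad (‖x‖ ^ 2) (1 + t) x y ^ (-1 - (n : ℝ) / 2)) := by
  have hn' : (3 : ℝ) ≤ n := by exact_mod_cast hn
  have h1 := laplacian_quad_rpow (quad_one_pos_of_pos ht x y)
  have h2 := laplacian_quad_rpow (quad_normSq_pos_of_pos ht x y)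
  rw [finrank_euclideanSpace_fin] at h1 h2
  have c1 := contDiffAt_quad_rpow (quad_one_pos_of_pos ht x y) (1 - (n : ℝ) / 2) (k := 2)
  have c2 := contDiffAt_quad_rpow (quad_normSq_pos_of_pos ht x y) (1 - (n : ℝ) / 2) (k := 2)
  have h3 : green t x = ((n : ℝ) * ((n : ℝ) - 2) * volume.real (unitBall n))⁻¹ •
      ((fun y => quad 1 (‖x‖ ^ 2 + t) x y ^ (1 - (n : ℝ) / 2)) -
        fun y => quad (‖x‖ ^ 2) (1 + t) x y ^ (1 - (n : ℝ) / 2)) := rfl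
  have c3 : ContDiffAt ℝ 2 ((fun y => quad 1 (‖x‖ ^ 2 + t) x y ^ (1 - (n : ℝ) / 2)) -
      fun y => quad (‖x‖ ^ 2) (1 + t) x y ^ (1 - (n : ℝ) / 2)) y := c1.sub c2
  rw [h3, InnerProductSpace.laplacian_smul _ c3, c1.laplacian_sub c2, h1, h2]
  have hv := volume_real_unitBall_pos n
  have h3 : (n : ℝ) - 2 ≠ 0 := by linarith
  have h4 : (n : ℝ) ≠ 0 := by linarith
  simp only [smul_eq_mul]
  field_simp
  ring

lemma green_eq_zero_left {t : ℝ} {x : Rn n} (hx : ‖x‖ = 1) (y : Rn n) : green t x y = 0 := by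
  rw [green, quad_one, quad_normSq, hx]; simp

lemma green_eq_zero_right {t : ℝ} {y : Rn n} (x : Rn n) (hy : ‖y‖ = 1) : green t x y = 0 := by
  rw [green, quad_one, quad_normSq, hy]; simp

lemma greenGrad_eq_zero_left {t : ℝ} {x : Rn n} (hx : ‖x‖ = 1) (y : Rn n) :
    greenGrad t x y = 0 := by
  rw [greenGrad, quad_one, quad_normSq, hx]; simp

/-- A common constant in the pointwise bounds of the Green function and its gradient. -/
def kernelConst (n : ℕ) : ℝ≥0 := Real.toNNReal (2 * ((n : ℝ) * volume.real (unitBall n))⁻¹)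

lemma kernelConst_pos (hn : 3 ≤ n) : 0 < kernelConst n := by
  have hv := volume_real_unitBall_pos n
  have hn' : (3 : ℝ) ≤ n := by exact_mod_cast hn
  exact Real.toNNReal_pos.2 (by positivity)

lemma enorm_le_kernelConst_mul_riesz {F : Type*} [NormedAddCommGroup F] (hn : 3 ≤ n) {β : ℝ}
    (hβ : 0 < β) {x y : Rn n} {v : F} (h : y ≠ x → ‖v‖ ≤ kernelConst n * ‖y - x‖ ^ (-β)) :
    ‖v‖ₑ ≤ kernelConst n * riesz β x y := by
  by_cases hxy : y = x
  · rw [hxy, riesz_self hβ, ENNReal.mul_top (by simpa using (kernelConst_pos hn).ne')]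
    exact le_top
  · rw [riesz_of_ne β hxy, ← ofReal_norm, ← ENNReal.ofReal_coe_nnreal,
      ← ENNReal.ofReal_mul (by positivity)]
    exact ENNReal.ofReal_le_ofReal (h hxy)

lemma rpow_le_norm_rpow {q s a : ℝ} (hs : 0 < s) (h : s ^ 2 ≤ q) (ha : a ≤ 0) :
    q ^ a ≤ s ^ (2 * a) := by
  calc q ^ a ≤ (s ^ 2) ^ a := Real.rpow_le_rpow_of_nonpos (by positivity) h ha
    _ = s ^ (2 * a) := by rw [← Real.rpow_natCast_mul hs.le]; norm_num

lemma enorm_green_le (hn : 3 ≤ n) {t : ℝ} (ht : 0 ≤ t) {x y : Rn n} (hx : ‖x‖ ≤ 1)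
    (hy : ‖y‖ ≤ 1) : ‖green t x y‖ₑ ≤ kernelConst n * riesz ((n : ℝ) - 2) x y := by
  have hn' : (3 : ℝ) ≤ n := by exact_mod_cast hn
  refine enorm_le_kernelConst_mul_riesz hn (by linarith) fun hxy => ?_
  have hv := volume_real_unitBall_pos n
  have hp : 0 < ‖y - x‖ := norm_pos_iff.2 (sub_ne_zero.2 hxy)
  have h1 : quad (‖x‖ ^ 2) (1 + t) x y ^ (1 - (n : ℝ) / 2) ≤
      quad 1 (‖x‖ ^ 2 + t) x y ^ (1 - (n : ℝ) / 2) :=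
    Real.rpow_le_rpow_of_nonpos (quad_one_pos ht hxy)
      ((quad_one t x y).le.trans (le_quad_normSq hx hy)) (by linarith)
  have h2 : quad 1 (‖x‖ ^ 2 + t) x y ^ (1 - (n : ℝ) / 2) ≤ ‖y - x‖ ^ (-((n : ℝ) - 2)) := by
    refine (rpow_le_norm_rpow hp ?_ (by linarith)).trans_eq (by ring_nf)
    rw [quad_one]; linarith
  have h3 : 0 ≤ quad (‖x‖ ^ 2) (1 + t) x y ^ (1 - (n : ℝ) / 2) :=
    Real.rpow_nonneg (le_trans (by positivity) (le_quad_normSq hx hy)) _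
  have h4 : ((n : ℝ) * ((n : ℝ) - 2) * volume.real (unitBall n))⁻¹ ≤ kernelConst n := by
    rw [kernelConst, Real.coe_toNNReal _ (by positivity)]
    have : ((n : ℝ) * ((n : ℝ) - 2) * volume.real (unitBall n))⁻¹ ≤
        ((n : ℝ) * volume.real (unitBall n))⁻¹ := by
      apply inv_anti₀ (by positivity)
      nlinarith [mul_pos (by linarith : (0 : ℝ) < n) hv]
    have : 0 < ((n : ℝ) * volume.real (unitBall n))⁻¹ := by positivity
    linarith
  have h5 : 0 ≤ ((n : ℝ) * ((n : ℝ) - 2) * volume.real (unitBall n))⁻¹ := by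
    have : 0 < (n : ℝ) - 2 := by linarith
    positivity
  rw [green, Real.norm_eq_abs, abs_of_nonneg (mul_nonneg h5 (by linarith))]
  exact mul_le_mul h4 (by linarith) (by linarith) (by positivity)

lemma enorm_greenGrad_le (hn : 3 ≤ n) {t : ℝ} (ht : 0 ≤ t) {x y : Rn n} (hx : ‖x‖ ≤ 1)
    (hy : ‖y‖ ≤ 1) : ‖greenGrad t x y‖ₑ ≤ kernelConst n * riesz ((n : ℝ) - 1) x y := by
  have hn' : (3 : ℝ) ≤ n := by exact_mod_cast hn
  refine enorm_le_kernelConst_mul_riesz hn (by linarith) fun hxy => ?_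
  have hv := volume_real_unitBall_pos n
  have hp : 0 < ‖y - x‖ := norm_pos_iff.2 (sub_ne_zero.2 hxy)
  have hN : ‖y - x‖ ^ 2 ≤ quad 1 (‖x‖ ^ 2 + t) x y := by rw [quad_one]; linarith
  have hQ : ‖y - x‖ ^ 2 ≤ quad (‖x‖ ^ 2) (1 + t) x y := by
    linarith [le_quad_normSq (t := t) hx hy]
  have hQ0 : 0 < quad (‖x‖ ^ 2) (1 + t) x y := lt_of_lt_of_le (by positivity) hQ
  have hN0 : 0 < quad 1 (‖x‖ ^ 2 + t) x y := lt_of_lt_of_le (by positivity) hN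
  have key {q : ℝ} {v : Rn n} (hq : 0 < q) (h1 : ‖y - x‖ ^ 2 ≤ q) (h2 : ‖v‖ ^ 2 ≤ q) :
      ‖q ^ (-((n : ℝ) / 2)) • v‖ ≤ ‖y - x‖ ^ (-((n : ℝ) - 1)) := by
    rw [norm_smul, Real.norm_of_nonneg (by positivity)]
    have h3 : ‖v‖ ≤ q ^ (1 / 2 : ℝ) := by
      rw [← Real.sqrt_eq_rpow]; exact Real.le_sqrt_of_sq_le h2
    calc q ^ (-((n : ℝ) / 2)) * ‖v‖ ≤ q ^ (-((n : ℝ) / 2)) * q ^ (1 / 2 : ℝ) := by gcongr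
      _ = q ^ ((1 - (n : ℝ)) / 2) := by rw [← Real.rpow_add hq]; ring_nf
      _ ≤ _ := (rpow_le_norm_rpow hp h1 (by linarith)).trans_eq (by ring_nf)
  have e1 := key hN0 hN (v := y - x) hN
  have e2 := key hQ0 hQ (v := ‖x‖ ^ 2 • y - x) (by
    rw [norm_smul_sub_sq _ (1 + t)]
    have h1 : ‖x‖ ^ 2 ≤ 1 := pow_le_one₀ (norm_nonneg x) hx
    nlinarith [mul_le_mul_of_nonneg_right h1 hQ0.le, mul_nonneg (sq_nonneg ‖x‖) ht])
  rw [greenGrad, norm_smul, Real.norm_of_nonneg (by positivity), kernelConst,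
    Real.coe_toNNReal _ (by positivity)]
  have := norm_sub_le (quad (‖x‖ ^ 2) (1 + t) x y ^ (-((n : ℝ) / 2)) • (‖x‖ ^ 2 • y - x))
    (quad 1 (‖x‖ ^ 2 + t) x y ^ (-((n : ℝ) / 2)) • (y - x))
  have h5 : 0 < ((n : ℝ) * volume.real (unitBall n))⁻¹ := by positivity
  nlinarith

lemma measurable_green (t : ℝ) : Measurable fun q : Rn n × Rn n => green t q.1 q.2 := by
  unfold green quad; fun_prop

lemma measurable_greenGrad (t : ℝ) : Measurable fun q : Rn n × Rn n => greenGrad t q.1 q.2 := by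
  unfold greenGrad quad; fun_prop

lemma quad_normSq_pos_of_ne {t : ℝ} (ht : 0 ≤ t) {x y : Rn n} (hx : ‖x‖ ≤ 1) (hy : ‖y‖ ≤ 1)
    (hxy : y ≠ x) : 0 < quad (‖x‖ ^ 2) (1 + t) x y := by
  refine lt_of_lt_of_le ?_ (le_quad_normSq hx hy)
  have hp : 0 < ‖y - x‖ := norm_pos_iff.2 (sub_ne_zero.2 hxy)
  positivity

lemma continuousAt_green {t : ℝ} (ht : 0 ≤ t) {x y : Rn n} (hx : ‖x‖ ≤ 1) (hy : ‖y‖ ≤ 1)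
    (hxy : y ≠ x) : ContinuousAt (fun q : ℝ × Rn n => green q.1 q.2 y) (t, x) := by
  have h1 := (quad_one_pos ht hxy).ne'
  have h2 := (quad_normSq_pos_of_ne ht hx hy hxy).ne'
  unfold green
  apply ContinuousAt.mul continuousAt_const
  apply ContinuousAt.sub
  · exact ContinuousAt.rpow_const (by unfold quad; fun_prop) (Or.inl h1)
  · exact ContinuousAt.rpow_const (by unfold quad; fun_prop) (Or.inl h2)

lemma continuousAt_greenGrad {t : ℝ} (ht : 0 ≤ t) {x y : Rn n} (hx : ‖x‖ ≤ 1) (hy : ‖y‖ ≤ 1)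
    (hxy : y ≠ x) : ContinuousAt (fun q : ℝ × Rn n => greenGrad q.1 q.2 y) (t, x) := by
  have h1 := (quad_one_pos ht hxy).ne'
  have h2 := (quad_normSq_pos_of_ne ht hx hy hxy).ne'
  unfold greenGrad
  apply ContinuousAt.fun_const_smul
  apply ContinuousAt.sub
  · apply ContinuousAt.fun_smul
    · exact ContinuousAt.rpow_const (by unfold quad; fun_prop) (Or.inl h2)
    · fun_prop
  · apply ContinuousAt.fun_smul
    · exact ContinuousAt.rpow_const (by unfold quad; fun_prop) (Or.inl h1)
    · fun_prop

lemma tendsto_green {x y : Rn n} (hx : ‖x‖ ≤ 1) (hy : ‖y‖ ≤ 1) (hxy : y ≠ x) :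
    Tendsto (fun t => green t x y) (𝓝[>] 0) (𝓝 (green 0 x y)) :=
  (ContinuousAt.comp (f := fun t : ℝ => (t, x)) (continuousAt_green le_rfl hx hy hxy)
    (by fun_prop)).continuousWithinAt

lemma tendsto_greenGrad {x y : Rn n} (hx : ‖x‖ ≤ 1) (hy : ‖y‖ ≤ 1) (hxy : y ≠ x) :
    Tendsto (fun t => greenGrad t x y) (𝓝[>] 0) (𝓝 (greenGrad 0 x y)) :=
  (ContinuousAt.comp (f := fun t : ℝ => (t, x)) (continuousAt_greenGrad le_rfl hx hy hxy)
    (by fun_prop)).continuousWithinAt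

/-- The corrector is `c_n Q(x, ·)^{1 - n/2}`, which is harmonic in the ball and agrees with the
fundamental solution on the sphere, where `Q(x, y) = |y - x|²`. -/
lemma isGreenFunction_green : IsGreenFunction (unitBall n) (green 0) := by
  intro x hx
  have hx' := mem_unitBall.1 hx
  have hΦ (y : Rn n) : fundamentalSolution n (y - x) =
      ((n : ℝ) * ((n : ℝ) - 2) * volume.real (unitBall n))⁻¹ *
        quad 1 (‖x‖ ^ 2 + 0) x y ^ (1 - (n : ℝ) / 2) := by
    rw [fundamentalSolution, quad_one, add_zero, ← Real.rpow_natCast_mul (norm_nonneg _),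
      div_eq_inv_mul]
    congr 2
    push_cast; ring
  refine ⟨fun y => ((n : ℝ) * ((n : ℝ) - 2) * volume.real (unitBall n))⁻¹ *
    quad (‖x‖ ^ 2) (1 + 0) x y ^ (1 - (n : ℝ) / 2), ?_, ?_, ?_, ?_⟩
  · intro y hy
    refine (continuousAt_const.mul ?_).continuousWithinAt
    exact (continuous_quad _ _ _).continuousAt.rpow_const
      (Or.inl (quad_normSq_pos le_rfl hx' (mem_closure_unitBall.1 hy)).ne')
  · intro y hy
    have hy' := mem_unitBall.1 hy
    refine InnerProductSpace.HarmonicAt.const_smul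
      (f := fun y => quad (‖x‖ ^ 2) (1 + 0) x y ^ (1 - (n : ℝ) / 2)) ⟨?_, ?_⟩
    · exact contDiffAt_quad_rpow (quad_normSq_pos le_rfl hx' hy'.le) _
    · filter_upwards [Metric.isOpen_ball.mem_nhds hy] with z hz
      have h := laplacian_quad_rpow (quad_normSq_pos le_rfl hx' (mem_unitBall.1 hz).le)
      rw [finrank_euclideanSpace_fin] at h
      rw [h]; simp
  · intro y hy
    simp only [hΦ, quad_one, quad_normSq, mem_frontier_unitBall.1 hy]; simp
  · intro y _ _
    rw [hΦ, green, mul_sub]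

/-! ### Estimates of Riesz potentials -/

lemma lintegral_enorm_rpow_ball_lt_top (hn : 1 ≤ n) {β : ℝ} (hβ : β < n) (r : ℝ) :
    ∫⁻ z in Metric.ball (0 : Rn n) r, (‖z‖ₑ ^ β)⁻¹ < ⊤ := by
  have h := integrableOn_ball_of_norm_le_rpow (E := Rn n) (μ := volume)
    (f := fun z : Rn n => ‖z‖ ^ (-β)) (C := 1) (α := β) (r := r)
    (by rwa [finrank_euclideanSpace_fin]) (by rwa [finrank_euclideanSpace_fin])
    (ae_of_all _ fun z => by rw [one_mul, Real.norm_of_nonneg (by positivity)])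
    (measurable_norm.pow_const _).aestronglyMeasurable
  have : Nonempty (Fin n) := ⟨⟨0, hn⟩⟩
  refine lt_of_eq_of_lt (lintegral_congr_ae ?_) h.2
  filter_upwards [ae_restrict_of_ae (Measure.ae_ne volume (0 : Rn n))] with z hz
  have hp : 0 < ‖z‖ := norm_pos_iff.2 hz
  rw [← ENNReal.rpow_neg, ← ofReal_norm, ENNReal.ofReal_rpow_of_pos hp,
    ← ofReal_norm, Real.norm_of_nonneg (by positivity)]

/-- The Riesz kernel of order `β < n` is integrable on the unit ball, uniformly in the pole. -/
lemma exists_lintegral_riesz_le (hn : 1 ≤ n) {β : ℝ} (hβ : β < n) :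
    ∃ A : ℝ≥0, ∀ x ∈ unitBall n, ∫⁻ y in unitBall n, riesz β x y ≤ A := by
  lift (∫⁻ z in Metric.ball (0 : Rn n) 2, (‖z‖ₑ ^ β)⁻¹) to ℝ≥0 using
    (lintegral_enorm_rpow_ball_lt_top hn hβ 2).ne with A hA
  refine ⟨A, fun x hx => ?_⟩
  rw [hA, ← lintegral_indicator measurableSet_ball,
    ← lintegral_indicator (measurableSet_unitBall n),
    ← lintegral_sub_left_eq_self (fun z => (Metric.ball (0 : Rn n) 2).indicator _ z) x]
  refine lintegral_mono fun y => ?_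
  by_cases hy : y ∈ unitBall n
  · rw [indicator_of_mem hy, indicator_of_mem]
    · rfl
    rw [mem_ball_zero_iff]
    have := norm_sub_le x y
    have := mem_unitBall.1 hx
    have := mem_unitBall.1 hy
    linarith
  · rw [indicator_of_notMem hy]
    exact zero_le

lemma lintegral_comp_smul_of_pos {f : Rn n → ℝ≥0∞} (hf : Measurable f) {r : ℝ} (hr : 0 < r) :
    ∫⁻ z, f z = ENNReal.ofReal r ^ (n : ℝ) * ∫⁻ z, f (r • z) := by
  have h := Measure.map_addHaar_smul (volume : Measure (Rn n)) hr.ne'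
  rw [finrank_euclideanSpace_fin] at h
  have h2 : ∫⁻ z, f (r • z) = ENNReal.ofReal |(r ^ n)⁻¹| * ∫⁻ z, f z := by
    rw [← smul_eq_mul, ← lintegral_smul_measure, ← h, lintegral_map hf (by fun_prop)]
  rw [h2, ← mul_assoc, ENNReal.ofReal_rpow_of_pos hr, ← ENNReal.ofReal_mul (by positivity),
    Real.rpow_natCast, abs_of_pos (by positivity), mul_inv_cancel₀ (by positivity),
    ENNReal.ofReal_one, one_mul]

/-- The radial majorant `|z|^{1 - n} max(|z|, δ)^{1 - n}` used for the composition of two Riesz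
kernels. -/
def rieszMajorant (δ : ℝ≥0∞) (z : Rn n) : ℝ≥0∞ :=
  (‖z‖ₑ ^ ((n : ℝ) - 1))⁻¹ * (max ‖z‖ₑ δ ^ ((n : ℝ) - 1))⁻¹

lemma measurable_rieszMajorant (δ : ℝ≥0∞) : Measurable (rieszMajorant (n := n) δ) := by
  unfold rieszMajorant; fun_prop

lemma lintegral_rieszMajorant_one_lt_top (hn : 3 ≤ n) :
    ∫⁻ z : Rn n, rieszMajorant 1 z < ⊤ := by
  have hn' : (3 : ℝ) ≤ n := by exact_mod_cast hn
  set a : ℝ := 2 * ((n : ℝ) - 1) with ha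
  have h1 := lintegral_enorm_rpow_ball_lt_top (n := n) (by omega)
    (show (n : ℝ) - 1 < n by linarith) 1
  have h2 : ∫⁻ z : Rn n, ENNReal.ofReal ((1 + ‖z‖) ^ (-a)) < ⊤ :=
    finite_integral_one_add_norm (by rw [finrank_euclideanSpace_fin]; linarith)
  rw [← lintegral_indicator measurableSet_ball] at h1
  calc ∫⁻ z : Rn n, rieszMajorant 1 z
      ≤ ∫⁻ z : Rn n, (((Metric.ball 0 1).indicator (fun z => (‖z‖ₑ ^ ((n : ℝ) - 1))⁻¹) z) +
          ENNReal.ofReal (2 ^ a) * ENNReal.ofReal ((1 + ‖z‖) ^ (-a))) := by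
        refine lintegral_mono fun z => ?_
        by_cases hz : z ∈ Metric.ball (0 : Rn n) 1
        · rw [indicator_of_mem hz]
          refine le_add_right (mul_le_of_le_one_right' ?_)
          rw [ENNReal.inv_le_one]
          exact ENNReal.one_le_rpow (le_max_right _ _) (by linarith)
        · rw [indicator_of_notMem hz, zero_add, ← ENNReal.ofReal_mul (by positivity)]
          have hz1 : 1 ≤ ‖z‖ := by simpa using hz
          have hz0 : 0 < ‖z‖ := by linarith
          have hm : max ‖z‖ₑ 1 = ‖z‖ₑ := by
            rw [max_eq_left]
            rw [← ofReal_norm]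
            simpa using ENNReal.ofReal_le_ofReal hz1
          rw [rieszMajorant, hm, ← ENNReal.rpow_neg, ← ofReal_norm,
            ENNReal.ofReal_rpow_of_pos hz0, ← ENNReal.ofReal_mul (by positivity),
            ← Real.rpow_add hz0]
          apply ENNReal.ofReal_le_ofReal
          calc ‖z‖ ^ (-((n : ℝ) - 1) + -((n : ℝ) - 1)) = ‖z‖ ^ (-a) := by rw [ha]; ring_nf
            _ ≤ ((1 + ‖z‖) / 2) ^ (-a) :=
              Real.rpow_le_rpow_of_nonpos (by positivity) (by linarith) (by linarith)
            _ = 2 ^ a * (1 + ‖z‖) ^ (-a) := by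
              rw [Real.div_rpow (by positivity) (by norm_num), Real.rpow_neg two_pos.le a,
                div_inv_eq_mul, mul_comm]
    _ = (∫⁻ z : Rn n, (Metric.ball 0 1).indicator (fun z => (‖z‖ₑ ^ ((n : ℝ) - 1))⁻¹) z) +
          ENNReal.ofReal (2 ^ a) * ∫⁻ z : Rn n, ENNReal.ofReal ((1 + ‖z‖) ^ (-a)) := by
        rw [lintegral_add_right _ (by fun_prop), lintegral_const_mul _ (by fun_prop)]
    _ < ⊤ := ENNReal.add_lt_top.2 ⟨h1, ENNReal.mul_lt_top ENNReal.ofReal_lt_top h2⟩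

lemma lintegral_rieszMajorant (hn : 3 ≤ n) {r : ℝ} (hr : 0 < r) :
    ∫⁻ z : Rn n, rieszMajorant (ENNReal.ofReal r) z =
      ENNReal.ofReal (r ^ (-((n : ℝ) - 2))) * ∫⁻ z : Rn n, rieszMajorant 1 z := by
  have hn' : (3 : ℝ) ≤ n := by exact_mod_cast hn
  set ρ := ENNReal.ofReal r with hρ
  have hρ0 : ρ ≠ 0 := by simpa [hρ] using hr
  have hρt : ρ ≠ ⊤ := ENNReal.ofReal_ne_top
  have h1 (z : Rn n) : rieszMajorant ρ (r • z) =
      ρ ^ (-(2 * ((n : ℝ) - 1))) * rieszMajorant 1 z := by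
    have e1 : ‖r • z‖ₑ = ρ * ‖z‖ₑ := by
      rw [enorm_smul, Real.enorm_eq_ofReal hr.le]
    have e2 : max (ρ * ‖z‖ₑ) ρ = ρ * max ‖z‖ₑ 1 := by rw [mul_max, mul_one]
    rw [rieszMajorant, rieszMajorant, e1, e2, ENNReal.mul_rpow_of_nonneg _ _ (by linarith),
      ENNReal.mul_rpow_of_nonneg _ _ (by linarith),
      ENNReal.mul_inv (by left; simp [hρ0, hρt]) (by left; simp [hρ0, hρt]),
      ENNReal.mul_inv (by left; simp [hρ0, hρt]) (by left; simp [hρ0, hρt]),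
      ← ENNReal.rpow_neg, show -(2 * ((n : ℝ) - 1)) = -((n : ℝ) - 1) + -((n : ℝ) - 1) by ring,
      ENNReal.rpow_add _ _ hρ0 hρt]
    ring
  rw [lintegral_comp_smul_of_pos (measurable_rieszMajorant _) hr]
  simp_rw [h1]
  rw [lintegral_const_mul _ (measurable_rieszMajorant _), ← mul_assoc,
    ← ENNReal.rpow_add _ _ hρ0 hρt, hρ, ENNReal.ofReal_rpow_of_pos hr]
  ring_nf

lemma riesz_mul_riesz_le (hn : 3 ≤ n) {x y z : Rn n} {δ : ℝ≥0∞}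
    (h1 : ‖y - z‖ₑ ≤ ‖x - y‖ₑ) (h2 : δ ≤ ‖x - y‖ₑ) :
    riesz ((n : ℝ) - 1) x y * riesz ((n : ℝ) - 1) y z ≤ rieszMajorant δ (y - z) := by
  have hn' : (3 : ℝ) ≤ n := by exact_mod_cast hn
  rw [mul_comm]
  refine mul_le_mul_right ?_ _
  rw [riesz, ENNReal.inv_le_inv]
  exact ENNReal.rpow_le_rpow (max_le h1 h2) (by linarith)

/-- Composition of two Riesz kernels:
`∫ |x - y|^{1 - n} |y - z|^{1 - n} dy ≤ A |x - z|^{2 - n}`. The larger of the two distances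
is at least `|x - z| / 2`, so the integrand is dominated by a radial function centred at `x` or at
`z`, whose integral is computed by scaling. -/
lemma exists_lintegral_riesz_mul_riesz_le (hn : 3 ≤ n) :
    ∃ A : ℝ≥0, ∀ x z : Rn n, ∫⁻ y, riesz ((n : ℝ) - 1) x y * riesz ((n : ℝ) - 1) y z ≤
      A * riesz ((n : ℝ) - 2) x z := by
  have hn' : (3 : ℝ) ≤ n := by exact_mod_cast hn
  lift (∫⁻ z : Rn n, rieszMajorant 1 z) to ℝ≥0 using
    (lintegral_rieszMajorant_one_lt_top hn).ne with M hM
  refine ⟨2 * Real.toNNReal (2 ^ ((n : ℝ) - 2)) * M + 1, fun x z => ?_⟩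
  by_cases hxz : z = x
  · rw [hxz, riesz_self (by linarith : (0 : ℝ) < n - 2), ENNReal.mul_top (by simp)]
    exact le_top
  have hd : 0 < ‖z - x‖ := norm_pos_iff.2 (sub_ne_zero.2 hxz)
  set r := ‖z - x‖ / 2 with hr
  have hr0 : 0 < r := by positivity
  have hδ : ENNReal.ofReal r = ‖z - x‖ₑ / 2 := by
    rw [hr, ENNReal.ofReal_div_of_pos two_pos, ofReal_norm]; simp
  calc ∫⁻ y, riesz ((n : ℝ) - 1) x y * riesz ((n : ℝ) - 1) y z
      ≤ ∫⁻ y, (rieszMajorant (ENNReal.ofReal r) (y - z) +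
          rieszMajorant (ENNReal.ofReal r) (y - x)) := by
        refine lintegral_mono fun y => ?_
        have htri : ‖z - x‖ ≤ ‖y - z‖ + ‖x - y‖ := by
          have := norm_add_le (z - y) (y - x)
          rw [sub_add_sub_cancel] at this
          rwa [norm_sub_rev z y, norm_sub_rev y x] at this
        rcases le_total ‖y - z‖ ‖x - y‖ with h | h
        · refine le_add_right (riesz_mul_riesz_le hn ?_ ?_)
          · rw [← ofReal_norm, ← ofReal_norm]; exact ENNReal.ofReal_le_ofReal h
          · rw [← ofReal_norm]; exact ENNReal.ofReal_le_ofReal (by linarith)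
        · refine le_add_left ?_
          rw [mul_comm, riesz_comm _ y z, riesz_comm _ x y]
          refine riesz_mul_riesz_le hn ?_ ?_
          · rw [← ofReal_norm, ← ofReal_norm, norm_sub_rev z y, norm_sub_rev y x]
            exact ENNReal.ofReal_le_ofReal h
          · rw [← ofReal_norm, norm_sub_rev z y]; exact ENNReal.ofReal_le_ofReal (by linarith)
    _ = 2 * (ENNReal.ofReal (r ^ (-((n : ℝ) - 2))) * M) := by
        have hm : Measurable fun y => rieszMajorant (ENNReal.ofReal r) (y - z) :=
          (measurable_rieszMajorant _).comp (by fun_prop)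
        rw [lintegral_add_left hm,
          lintegral_sub_right_eq_self (rieszMajorant (ENNReal.ofReal r)),
          lintegral_sub_right_eq_self (rieszMajorant (ENNReal.ofReal r)),
          lintegral_rieszMajorant hn hr0, hM, two_mul]
    _ = (2 * Real.toNNReal (2 ^ ((n : ℝ) - 2)) * M : ℝ≥0) * riesz ((n : ℝ) - 2) x z := by
        rw [riesz_of_ne _ hxz, hr, Real.div_rpow hd.le two_pos.le,
          Real.rpow_neg two_pos.le, div_inv_eq_mul, ENNReal.ofReal_mul (by positivity)]
        push_cast
        rw [ENNReal.ofReal, ENNReal.ofReal]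
        ring_nf
    _ ≤ _ := by gcongr; exact le_self_add

/-- The Cauchy-Schwarz inequality with a weight `k`. -/
lemma lintegral_mul_sq_le {α : Type*} [MeasurableSpace α] {μ : Measure α} {k p : α → ℝ≥0∞}
    (hk : AEMeasurable k μ) (hp : AEMeasurable p μ) :
    (∫⁻ y, k y * p y ∂μ) ^ 2 ≤ (∫⁻ y, k y ∂μ) * ∫⁻ y, k y * p y ^ 2 ∂μ := by
  have hsq (t : ℝ≥0∞) : (t ^ (1 / 2 : ℝ)) ^ (2 : ℝ) = t := by
    rw [← ENNReal.rpow_mul]; norm_num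
  have h2 (t : ℝ≥0∞) : (t ^ (1 / 2 : ℝ)) ^ 2 = t := by
    rw [← ENNReal.rpow_natCast]; exact hsq t
  have h := ENNReal.lintegral_mul_le_Lp_mul_Lq μ Real.HolderConjugate.two_two
    (hk.pow_const (1 / 2 : ℝ)) ((hk.pow_const (1 / 2 : ℝ)).mul hp)
  have e1 (y : α) : ((fun y => k y ^ (1 / 2 : ℝ)) * ((fun y => k y ^ (1 / 2 : ℝ)) * p)) y =
      k y * p y := by
    simp only [Pi.mul_apply]
    rw [← mul_assoc, ← sq, h2]
  have e2 (y : α) : ((fun y => k y ^ (1 / 2 : ℝ)) * p) y ^ (2 : ℝ) = k y * p y ^ 2 := by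
    simp only [Pi.mul_apply]
    rw [ENNReal.mul_rpow_of_nonneg _ _ (by norm_num), hsq]
    norm_num
  simp_rw [e1, e2, hsq] at h
  calc (∫⁻ y, k y * p y ∂μ) ^ 2 ≤ _ := pow_le_pow_left' h 2
    _ = _ := by rw [mul_pow, h2, h2]

/-- The Riesz potential of order one of `q` on the unit ball: `∫_{B₁} |x - y|^{1 - n} q(y) dy`. -/
def rieszPot (q : Rn n → ℝ≥0∞) (x : Rn n) : ℝ≥0∞ :=
  ∫⁻ y in unitBall n, riesz ((n : ℝ) - 1) x y * q y

lemma aemeasurable_riesz_mul (β : ℝ) {μ : Measure (Rn n)} [SFinite μ] {q : Rn n → ℝ≥0∞}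
    (hq : AEMeasurable q μ) :
    AEMeasurable (Function.uncurry fun x y => riesz β x y * q y) (μ.prod μ) :=
  (measurable_riesz β).aemeasurable.mul hq.comp_snd

lemma aemeasurable_rieszPot {q : Rn n → ℝ≥0∞}
    (hq : AEMeasurable q (volume.restrict (unitBall n))) :
    AEMeasurable (rieszPot q) (volume.restrict (unitBall n)) :=
  (aemeasurable_riesz_mul _ hq).lintegral_prod_right'

/-- The Riesz potential of order one is bounded on `L²(B₁)`. -/
lemma exists_lintegral_rieszPot_sq_le (hn : 3 ≤ n) :
    ∃ A : ℝ≥0, ∀ q : Rn n → ℝ≥0∞, AEMeasurable q (volume.restrict (unitBall n)) →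
      ∫⁻ x in unitBall n, rieszPot q x ^ 2 ≤ A * ∫⁻ y in unitBall n, q y ^ 2 := by
  obtain ⟨A, hA⟩ := exists_lintegral_riesz_le (n := n) (by omega)
    (show (n : ℝ) - 1 < n by linarith)
  refine ⟨A * A, fun q hq => ?_⟩
  have hm := aemeasurable_riesz_mul ((n : ℝ) - 1) (hq.pow_const 2)
  calc ∫⁻ x in unitBall n, rieszPot q x ^ 2
      ≤ ∫⁻ x in unitBall n, A * ∫⁻ y in unitBall n, riesz ((n : ℝ) - 1) x y * q y ^ 2 := by
        refine setLIntegral_mono' (measurableSet_unitBall n) fun x hx => ?_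
        refine (lintegral_mul_sq_le (by fun_prop) hq).trans ?_
        gcongr
        exact hA x hx
    _ = A * ∫⁻ y in unitBall n, ∫⁻ x in unitBall n, riesz ((n : ℝ) - 1) x y * q y ^ 2 := by
        rw [lintegral_const_mul'' _ (f := fun x => ∫⁻ y in unitBall n,
          riesz ((n : ℝ) - 1) x y * q y ^ 2) hm.lintegral_prod_right', lintegral_lintegral_swap hm]
    _ ≤ A * ∫⁻ y in unitBall n, A * q y ^ 2 := by
        gcongr 1
        refine setLIntegral_mono' (measurableSet_unitBall n) fun y hy => ?_
        rw [lintegral_mul_const _ (by fun_prop)]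
        gcongr
        simp_rw [riesz_comm _ _ y]
        exact hA y hy
    _ = _ := by
        rw [lintegral_const_mul'' _ (hq.pow_const 2), ← mul_assoc, ENNReal.coe_mul]

/-- The `L²` norm of the Riesz potential of order one of `q` is controlled by the `L¹` norm of `q`
and the supremum of its Riesz potential of order two. -/
lemma exists_lintegral_rieszPot_sq_le_mul (hn : 3 ≤ n) :
    ∃ A : ℝ≥0, ∀ (q : Rn n → ℝ≥0∞) (S : ℝ≥0∞), AEMeasurable q (volume.restrict (unitBall n)) →
      (∀ x ∈ unitBall n, ∫⁻ y in unitBall n, riesz ((n : ℝ) - 2) x y * q y ≤ S) →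
      ∫⁻ x in unitBall n, rieszPot q x ^ 2 ≤ A * S * ∫⁻ y in unitBall n, q y := by
  obtain ⟨A, hA⟩ := exists_lintegral_riesz_mul_riesz_le hn
  refine ⟨A, fun q S hq hS => ?_⟩
  have hm := aemeasurable_riesz_mul ((n : ℝ) - 1) hq
  have hP := aemeasurable_rieszPot hq
  have h1 (z : Rn n) (hz : z ∈ unitBall n) :
      ∫⁻ x in unitBall n, riesz ((n : ℝ) - 1) x z * rieszPot q x ≤ A * S := by
    calc ∫⁻ x in unitBall n, riesz ((n : ℝ) - 1) x z * rieszPot q x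
        = ∫⁻ x in unitBall n, ∫⁻ y in unitBall n,
            riesz ((n : ℝ) - 1) x z * (riesz ((n : ℝ) - 1) x y * q y) := by
          refine lintegral_congr fun x => ?_
          rw [rieszPot, lintegral_const_mul'' _ (by fun_prop)]
      _ = ∫⁻ y in unitBall n, ∫⁻ x in unitBall n,
            riesz ((n : ℝ) - 1) x z * (riesz ((n : ℝ) - 1) x y * q y) :=
          lintegral_lintegral_swap
            (((measurable_riesz_left _ z).comp measurable_fst).aemeasurable.mul hm)
      _ ≤ ∫⁻ y in unitBall n, A * (riesz ((n : ℝ) - 2) z y * q y) := by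
          refine lintegral_mono fun y => ?_
          have e (x : Rn n) : riesz ((n : ℝ) - 1) x z * (riesz ((n : ℝ) - 1) x y * q y) =
              riesz ((n : ℝ) - 1) z x * riesz ((n : ℝ) - 1) x y * q y := by
            rw [riesz_comm _ x z, mul_assoc]
          simp_rw [e]
          rw [lintegral_mul_const _ (by fun_prop), ← mul_assoc]
          gcongr
          exact (setLIntegral_le_lintegral _ _).trans (hA z y)
      _ ≤ A * S := by
          rw [lintegral_const_mul'' _ (by fun_prop)]
          gcongr
          exact hS z hz
  calc ∫⁻ x in unitBall n, rieszPot q x ^ 2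
      = ∫⁻ x in unitBall n, ∫⁻ z in unitBall n,
          riesz ((n : ℝ) - 1) x z * q z * rieszPot q x := by
        refine lintegral_congr fun x => ?_
        rw [lintegral_mul_const'' _ (by fun_prop), sq]
        rfl
    _ = ∫⁻ z in unitBall n, ∫⁻ x in unitBall n,
          riesz ((n : ℝ) - 1) x z * q z * rieszPot q x :=
        lintegral_lintegral_swap (hm.mul hP.comp_fst)
    _ ≤ ∫⁻ z in unitBall n, A * S * q z := by
        refine setLIntegral_mono' (measurableSet_unitBall n) fun z hz => ?_
        have e (x : Rn n) : riesz ((n : ℝ) - 1) x z * q z * rieszPot q x =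
            riesz ((n : ℝ) - 1) x z * rieszPot q x * q z := by ring
        simp_rw [e]
        rw [lintegral_mul_const'' _ (by fun_prop)]
        gcongr
        exact h1 z hz
    _ = A * S * ∫⁻ y in unitBall n, q y := lintegral_const_mul'' _ hq

/-! ### Integrals against the Green function -/

/-- Dominated convergence with an extended-valued majorant. -/
lemma tendsto_integral_of_enorm_le {α ι : Type*} [MeasurableSpace α] {μ : Measure α}
    {l : Filter ι} [l.IsCountablyGenerated] {F : ι → α → ℝ} {f : α → ℝ} {b : α → ℝ≥0∞}
    (hb : AEMeasurable b μ) (hbt : ∫⁻ a, b a ∂μ ≠ ⊤)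
    (hF : ∀ᶠ i in l, AEStronglyMeasurable (F i) μ)
    (hle : ∀ᶠ i in l, ∀ᵐ a ∂μ, ‖F i a‖ₑ ≤ b a)
    (hlim : ∀ᵐ a ∂μ, Tendsto (fun i => F i a) l (𝓝 (f a))) :
    Tendsto (fun i => ∫ a, F i a ∂μ) l (𝓝 (∫ a, f a ∂μ)) := by
  refine tendsto_integral_filter_of_dominated_convergence (fun a => (b a).toReal) hF ?_
    (integrable_toReal_of_lintegral_ne_top hb hbt) hlim
  filter_upwards [hle] with i hi
  filter_upwards [hi, ae_lt_top' hb hbt] with a ha hat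
  rw [← toReal_enorm]
  exact ENNReal.toReal_mono hat.ne ha

lemma aemeasurable_riesz_mul_right (β : ℝ) (x : Rn n) {μ : Measure (Rn n)} {q : Rn n → ℝ≥0∞}
    (hq : AEMeasurable q μ) : AEMeasurable (fun y => riesz β x y * q y) μ :=
  (measurable_riesz_right β x).aemeasurable.mul hq

lemma enorm_inner_greenGrad_le (hn : 3 ≤ n) {t : ℝ} (ht : 0 ≤ t) {x y : Rn n} (hx : ‖x‖ ≤ 1)
    (hy : ‖y‖ ≤ 1) (v : Rn n) :
    ‖inner ℝ (greenGrad t x y) v‖ₑ ≤ kernelConst n * (riesz ((n : ℝ) - 1) x y * ‖v‖ₑ) := by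
  rw [← mul_assoc]
  refine le_trans ?_ (mul_le_mul_left (enorm_greenGrad_le hn ht hx hy) _)
  rw [← ofReal_norm, ← ofReal_norm, ← ofReal_norm, ← ENNReal.ofReal_mul (norm_nonneg _)]
  exact ENNReal.ofReal_le_ofReal (norm_inner_le_norm _ _)

lemma enorm_green_mul_le (hn : 3 ≤ n) {t : ℝ} (ht : 0 ≤ t) {x y : Rn n} (hx : ‖x‖ ≤ 1)
    (hy : ‖y‖ ≤ 1) (v : ℝ) :
    ‖green t x y * v‖ₑ ≤ kernelConst n * (riesz ((n : ℝ) - 2) x y * ‖v‖ₑ) := by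
  rw [← mul_assoc, enorm_mul]
  exact mul_le_mul_left (enorm_green_le hn ht hx hy) _

lemma aestronglyMeasurable_inner_greenGrad (t : ℝ) (x : Rn n) {μ : Measure (Rn n)}
    {F : Rn n → Rn n} (hF : AEStronglyMeasurable F μ) :
    AEStronglyMeasurable (fun y => inner ℝ (greenGrad t x y) (F y)) μ :=
  ((measurable_greenGrad t).comp (measurable_const.prodMk measurable_id)).aestronglyMeasurable.inner
    hF

lemma aestronglyMeasurable_green_mul (t : ℝ) (x : Rn n) {μ : Measure (Rn n)}
    {g : Rn n → ℝ} (hg : AEStronglyMeasurable g μ) :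
    AEStronglyMeasurable (fun y => green t x y * g y) μ :=
  ((measurable_green t).comp (measurable_const.prodMk measurable_id)).aestronglyMeasurable.mul hg

lemma lintegral_enorm_inner_greenGrad_le (hn : 3 ≤ n) {t : ℝ} (ht : 0 ≤ t) {x : Rn n}
    (hx : ‖x‖ ≤ 1) {F : Rn n → Rn n}
    (hF : AEStronglyMeasurable F (volume.restrict (unitBall n))) :
    ∫⁻ y in unitBall n, ‖inner ℝ (greenGrad t x y) (F y)‖ₑ ≤
      kernelConst n * rieszPot (fun y => ‖F y‖ₑ) x := by
  rw [rieszPot, ← lintegral_const_mul'' _ (aemeasurable_riesz_mul_right _ x hF.enorm)]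
  exact setLIntegral_mono' (measurableSet_unitBall n) fun y hy =>
    enorm_inner_greenGrad_le hn ht hx (norm_le_one_of_mem hy) _

lemma lintegral_enorm_green_mul_le (hn : 3 ≤ n) {t : ℝ} (ht : 0 ≤ t) {x : Rn n}
    (hx : ‖x‖ ≤ 1) {g : Rn n → ℝ}
    (hg : AEStronglyMeasurable g (volume.restrict (unitBall n))) :
    ∫⁻ y in unitBall n, ‖green t x y * g y‖ₑ ≤
      kernelConst n * ∫⁻ y in unitBall n, riesz ((n : ℝ) - 2) x y * ‖g y‖ₑ := by
  rw [← lintegral_const_mul'' _ (aemeasurable_riesz_mul_right _ x hg.enorm)]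
  exact setLIntegral_mono' (measurableSet_unitBall n) fun y hy =>
    enorm_green_mul_le hn ht hx (norm_le_one_of_mem hy) _

lemma integrableOn_inner_greenGrad (hn : 3 ≤ n) {t : ℝ} (ht : 0 ≤ t) {x : Rn n}
    (hx : ‖x‖ ≤ 1) {F : Rn n → Rn n}
    (hF : AEStronglyMeasurable F (volume.restrict (unitBall n)))
    (hP : rieszPot (fun y => ‖F y‖ₑ) x ≠ ⊤) :
    IntegrableOn (fun y => inner ℝ (greenGrad t x y) (F y)) (unitBall n) :=
  ⟨aestronglyMeasurable_inner_greenGrad t x hF,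
    (lintegral_enorm_inner_greenGrad_le hn ht hx hF).trans_lt
      (ENNReal.mul_lt_top ENNReal.coe_lt_top hP.lt_top)⟩

lemma integrableOn_green_mul (hn : 3 ≤ n) {t : ℝ} (ht : 0 ≤ t) {x : Rn n}
    (hx : ‖x‖ ≤ 1) {g : Rn n → ℝ}
    (hg : AEStronglyMeasurable g (volume.restrict (unitBall n)))
    (hP : ∫⁻ y in unitBall n, riesz ((n : ℝ) - 2) x y * ‖g y‖ₑ ≠ ⊤) :
    IntegrableOn (fun y => green t x y * g y) (unitBall n) :=
  ⟨aestronglyMeasurable_green_mul t x hg,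
    (lintegral_enorm_green_mul_le hn ht hx hg).trans_lt
      (ENNReal.mul_lt_top ENNReal.coe_lt_top hP.lt_top)⟩

lemma nontrivial_Rn (hn : 3 ≤ n) : Nontrivial (Rn n) := by
  have : Nonempty (Fin n) := ⟨⟨0, by omega⟩⟩
  infer_instance

lemma ae_ne_and_mem (hn : 3 ≤ n) (x : Rn n) :
    ∀ᵐ y ∂(volume.restrict (unitBall n)), y ≠ x ∧ ‖y‖ ≤ 1 := by
  have := nontrivial_Rn hn
  filter_upwards [ae_restrict_of_ae (Measure.ae_ne volume x),
    ae_restrict_mem (measurableSet_unitBall n)] with y h1 h2 using ⟨h1, norm_le_one_of_mem h2⟩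

lemma tendsto_integral_inner_greenGrad (hn : 3 ≤ n) {x : Rn n} (hx : ‖x‖ ≤ 1) {F : Rn n → Rn n}
    (hF : AEStronglyMeasurable F (volume.restrict (unitBall n)))
    (hP : rieszPot (fun y => ‖F y‖ₑ) x ≠ ⊤) :
    Tendsto (fun t => ∫ y in unitBall n, inner ℝ (greenGrad t x y) (F y)) (𝓝[>] 0)
      (𝓝 (∫ y in unitBall n, inner ℝ (greenGrad 0 x y) (F y))) := by
  have hm : AEMeasurable (fun y => riesz ((n : ℝ) - 1) x y * ‖F y‖ₑ)
    (volume.restrict (unitBall n)) := aemeasurable_riesz_mul_right _ x hF.enorm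
  refine tendsto_integral_of_enorm_le
    (b := fun y => kernelConst n * (riesz ((n : ℝ) - 1) x y * ‖F y‖ₑ))
    (hm.const_mul _) ?_ (Eventually.of_forall fun t =>
      aestronglyMeasurable_inner_greenGrad t x hF) ?_ ?_
  · rw [lintegral_const_mul'' _ hm]
    exact ENNReal.mul_ne_top ENNReal.coe_ne_top hP
  · filter_upwards [self_mem_nhdsWithin] with t ht
    filter_upwards [ae_ne_and_mem hn x] with y hy
    exact enorm_inner_greenGrad_le hn (le_of_lt ht) hx hy.2 _
  · filter_upwards [ae_ne_and_mem hn x] with y hy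
    exact (tendsto_greenGrad hx hy.2 hy.1).inner tendsto_const_nhds

lemma tendsto_integral_green_mul (hn : 3 ≤ n) {x : Rn n} (hx : ‖x‖ ≤ 1) {g : Rn n → ℝ}
    (hg : AEStronglyMeasurable g (volume.restrict (unitBall n)))
    (hP : ∫⁻ y in unitBall n, riesz ((n : ℝ) - 2) x y * ‖g y‖ₑ ≠ ⊤) :
    Tendsto (fun t => ∫ y in unitBall n, green t x y * g y) (𝓝[>] 0)
      (𝓝 (∫ y in unitBall n, green 0 x y * g y)) := by
  have hm : AEMeasurable (fun y => riesz ((n : ℝ) - 2) x y * ‖g y‖ₑ)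
    (volume.restrict (unitBall n)) := aemeasurable_riesz_mul_right _ x hg.enorm
  refine tendsto_integral_of_enorm_le
    (b := fun y => kernelConst n * (riesz ((n : ℝ) - 2) x y * ‖g y‖ₑ))
    (hm.const_mul _) ?_ (Eventually.of_forall fun t =>
      aestronglyMeasurable_green_mul t x hg) ?_ ?_
  · rw [lintegral_const_mul'' _ hm]
    exact ENNReal.mul_ne_top ENNReal.coe_ne_top hP
  · filter_upwards [self_mem_nhdsWithin] with t ht
    filter_upwards [ae_ne_and_mem hn x] with y hy
    exact enorm_green_mul_le hn (le_of_lt ht) hx hy.2 _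
  · filter_upwards [ae_ne_and_mem hn x] with y hy
    exact (tendsto_green hx hy.2 hy.1).mul tendsto_const_nhds

lemma rieszPot_ne_top_of_bounded (hn : 3 ≤ n) {q : Rn n → ℝ≥0∞} {M : ℝ≥0} (hq : ∀ y, q y ≤ M)
    {x : Rn n} (hx : x ∈ unitBall n) : rieszPot q x ≠ ⊤ := by
  obtain ⟨A, hA⟩ := exists_lintegral_riesz_le (n := n) (by omega)
    (show (n : ℝ) - 1 < n by linarith)
  refine ne_top_of_le_ne_top (ENNReal.mul_ne_top (ENNReal.coe_ne_top (r := A))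
    (ENNReal.coe_ne_top (r := M))) ?_
  calc rieszPot q x ≤ ∫⁻ y in unitBall n, riesz ((n : ℝ) - 1) x y * M := by
        unfold rieszPot; gcongr with y; exact hq y
    _ = (∫⁻ y in unitBall n, riesz ((n : ℝ) - 1) x y) * M :=
        lintegral_mul_const _ (by fun_prop)
    _ ≤ A * M := by gcongr; exact hA x hx

/-! ### The reproducing formula for test functions -/

lemma IsTestFunction.eq_zero {Ω : Set (Rn n)} {φ : Rn n → ℝ} (hφ : IsTestFunction Ω φ) {y : Rn n}
    (hy : y ∉ Ω) : φ y = 0 := by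
  by_contra h
  exact hy (hφ.tsupport_subset (subset_tsupport φ h))

/-- The total mass of the approximate identity coming from the regularized Newton kernel. -/
lemma integral_one_add_norm_sq_rpow (hn : 3 ≤ n) :
    ∫ z : Rn n, (1 + ‖z‖ ^ 2) ^ (-1 - (n : ℝ) / 2) = volume.real (unitBall n) := by
  have hn' : (3 : ℝ) ≤ n := by exact_mod_cast hn
  have := nontrivial_Rn hn
  have hpos (r : ℝ) : 0 < 1 + r ^ 2 := by positivity
  rw [integral_fun_norm_addHaar volume (fun r : ℝ => (1 + r ^ 2) ^ (-1 - (n : ℝ) / 2)),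
    finrank_euclideanSpace_fin]
  have hd (r : ℝ) : HasDerivAt (fun r : ℝ => (n : ℝ)⁻¹ * (r ^ n * (1 + r ^ 2) ^ (-((n : ℝ) / 2))))
      (r ^ (n - 1) • (1 + r ^ 2) ^ (-1 - (n : ℝ) / 2)) r := by
    have h1 : HasDerivAt (fun r : ℝ => 1 + r ^ 2) (2 * r) r := by
      simpa using (hasDerivAt_pow 2 r).const_add 1
    have h2 := h1.rpow_const (p := -((n : ℝ) / 2)) (Or.inl (hpos r).ne')
    refine (((hasDerivAt_pow n r).mul h2).const_mul (n : ℝ)⁻¹).congr_deriv ?_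
    have e1 : r ^ n = r ^ (n - 1) * r := by rw [← pow_succ]; congr 1; omega
    have e2 : (1 + r ^ 2) ^ (-((n : ℝ) / 2)) =
        (1 + r ^ 2) ^ (-1 - (n : ℝ) / 2) * (1 + r ^ 2) := by
      rw [← Real.rpow_add_one (hpos r).ne']; ring_nf
    rw [e1, e2, show -((n : ℝ) / 2) - 1 = -1 - (n : ℝ) / 2 by ring, smul_eq_mul]
    field_simp
    ring
  have hlim : Tendsto (fun r : ℝ => (n : ℝ)⁻¹ * (r ^ n * (1 + r ^ 2) ^ (-((n : ℝ) / 2)))) atTop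
      (𝓝 ((n : ℝ)⁻¹ * 1)) := by
    refine Tendsto.const_mul _ ?_
    have h1 : Tendsto (fun r : ℝ => ((r ^ 2)⁻¹ + 1) ^ (-((n : ℝ) / 2))) atTop (𝓝 1) := by
      have h2 : Tendsto (fun r : ℝ => (r ^ 2)⁻¹ + 1) atTop (𝓝 (0 + 1)) :=
        ((tendsto_pow_atTop two_ne_zero).inv_tendsto_atTop).add_const 1
      have h3 := h2.rpow_const (p := -((n : ℝ) / 2)) (Or.inl (by norm_num))
      simpa using h3
    refine h1.congr' ?_
    filter_upwards [eventually_gt_atTop 0] with r hr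
    have e1 : r ^ n = (r ^ 2) ^ ((n : ℝ) / 2) := by
      rw [← Real.rpow_natCast_mul hr.le, ← Real.rpow_natCast]
      congr 1; push_cast; ring
    have e2 : 1 + r ^ 2 = r ^ 2 * ((r ^ 2)⁻¹ + 1) := by field_simp
    rw [e2, Real.mul_rpow (by positivity) (by positivity), e1, ← mul_assoc,
      ← Real.rpow_add (by positivity), add_neg_cancel, Real.rpow_zero, one_mul]
  rw [integral_Ioi_of_hasDerivAt_of_nonneg' (fun r _ => hd r)
    (fun r hr => by have : (0 : ℝ) < r := hr; positivity) hlim]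
  have : (n : ℝ) ≠ 0 := by linarith
  rw [zero_pow (by omega)]
  simp only [nsmul_eq_mul, smul_eq_mul]
  change (n : ℝ) * (volume.real (unitBall n) * _) = _
  field_simp
  ring

/-- The regularized Newton kernels are an approximate identity. -/
lemma tendsto_integral_quad_one_mul (hn : 3 ≤ n) {φ : Rn n → ℝ} (hφ : Continuous φ)
    (hc : HasCompactSupport φ) (x : Rn n) :
    Tendsto (fun c : ℝ => ∫ y, (volume.real (unitBall n))⁻¹ *
      ((c ^ 2)⁻¹ * quad 1 (‖x‖ ^ 2 + (c ^ 2)⁻¹) x y ^ (-1 - (n : ℝ) / 2)) * φ y) atTop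
      (𝓝 (φ x)) := by
  have hn' : (3 : ℝ) ≤ n := by exact_mod_cast hn
  have hv := volume_real_unitBall_pos n
  have hlim : Tendsto (fun z : Rn n => ‖z‖ ^ Module.finrank ℝ (Rn n) *
      ((volume.real (unitBall n))⁻¹ * (1 + ‖z‖ ^ 2) ^ (-1 - (n : ℝ) / 2)))
      (Bornology.cobounded (Rn n)) (𝓝 0) := by
    have h1 : Tendsto (fun r : ℝ => (volume.real (unitBall n))⁻¹ * r ^ (-2 : ℝ)) atTop (𝓝 0) := by
      have := (tendsto_rpow_neg_atTop (y := 2) (by norm_num)).const_mul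
        ((volume.real (unitBall n))⁻¹)
      simpa using this
    refine squeeze_zero' (Eventually.of_forall fun z => by positivity) ?_
      (h1.comp tendsto_norm_cobounded_atTop)
    filter_upwards [tendsto_norm_cobounded_atTop.eventually (eventually_gt_atTop 0)] with z hz
    rw [finrank_euclideanSpace_fin, mul_left_comm]
    refine mul_le_mul_of_nonneg_left ?_ (by positivity)
    calc ‖z‖ ^ n * (1 + ‖z‖ ^ 2) ^ (-1 - (n : ℝ) / 2)
        ≤ ‖z‖ ^ n * ‖z‖ ^ (2 * (-1 - (n : ℝ) / 2)) := by
          gcongr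
          exact rpow_le_norm_rpow hz (by linarith) (by linarith)
      _ = ‖z‖ ^ (-2 : ℝ) := by
          rw [← Real.rpow_natCast, ← Real.rpow_add hz]; congr 1; ring
  have h := tendsto_integral_comp_smul_smul_of_integrable' (μ := (volume : Measure (Rn n)))
    (φ := fun z => (volume.real (unitBall n))⁻¹ * (1 + ‖z‖ ^ 2) ^ (-1 - (n : ℝ) / 2))
    (fun z => by positivity)
    (by rw [integral_const_mul, integral_one_add_norm_sq_rpow hn, inv_mul_cancel₀ hv.ne'])
    hlim (g := φ) (x₀ := x) (hφ.integrable_of_hasCompactSupport hc) hφ.continuousAt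
  refine h.congr' ?_
  filter_upwards [eventually_gt_atTop 0] with c hc0
  refine integral_congr_ae (Eventually.of_forall fun y => ?_)
  simp only [smul_eq_mul]
  congr 1
  rw [mul_left_comm, quad_one, finrank_euclideanSpace_fin, norm_smul,
    Real.norm_of_nonneg hc0.le, norm_sub_rev x y]
  congr 1
  have e : 1 + (c * ‖y - x‖) ^ 2 = c ^ 2 * (‖y - x‖ ^ 2 + (c ^ 2)⁻¹) := by field_simp; ring
  rw [e, Real.mul_rpow (by positivity) (by positivity), ← mul_assoc]
  congr 1
  rw [← Real.rpow_natCast_mul hc0.le, ← Real.rpow_natCast, ← Real.rpow_add hc0, ← Real.rpow_natCast,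
    ← Real.rpow_neg hc0.le]
  congr 1; push_cast; ring

/-- The Laplacian of the regularized corrector does not contribute in the limit: its pole lies
outside of the closed ball. -/
lemma tendsto_integral_quad_normSq_mul (hn : 3 ≤ n) {φ : Rn n → ℝ}
    (hφ : IsTestFunction (unitBall n) φ) {x : Rn n} (hx : x ∈ unitBall n) :
    Tendsto (fun t : ℝ => ∫ y, (volume.real (unitBall n))⁻¹ *
      (t * ‖x‖ ^ 2 * quad (‖x‖ ^ 2) (1 + t) x y ^ (-1 - (n : ℝ) / 2)) * φ y) (𝓝[>] 0)
      (𝓝 0) := by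
  have hn' : (3 : ℝ) ≤ n := by exact_mod_cast hn
  have hv := volume_real_unitBall_pos n
  have hx' := mem_unitBall.1 hx
  have hint : Integrable φ := hφ.contDiff.continuous.integrable_of_hasCompactSupport
    hφ.hasCompactSupport
  set D : ℝ := (volume.real (unitBall n))⁻¹ * ((1 - ‖x‖) ^ (2 * (-1 - (n : ℝ) / 2)))
  have hD : Tendsto (fun t : ℝ => t * (D * ∫ y, ‖φ y‖)) (𝓝[>] 0) (𝓝 0) := by
    have : Tendsto (fun t : ℝ => t * (D * ∫ y, ‖φ y‖)) (𝓝 0) (𝓝 (0 * (D * ∫ y, ‖φ y‖))) :=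
      tendsto_id.mul_const _
    rw [zero_mul] at this
    exact this.mono_left nhdsWithin_le_nhds
  refine squeeze_zero_norm' ?_ hD
  filter_upwards [self_mem_nhdsWithin] with t ht
  have ht' : 0 < t := ht
  rw [← mul_assoc, ← integral_const_mul]
  refine norm_integral_le_of_norm_le (hint.norm.const_mul _) (Eventually.of_forall fun y => ?_)
  by_cases hy : y ∈ unitBall n
  · rw [norm_mul]
    gcongr
    have hy' := mem_unitBall.1 hy
    have hq : (1 - ‖x‖) ^ 2 ≤ quad (‖x‖ ^ 2) (1 + t) x y := by
      have h1 : inner ℝ x y ≤ ‖x‖ * ‖y‖ := real_inner_le_norm x y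
      have h2 : ‖x‖ * ‖y‖ ≤ ‖x‖ := by nlinarith [norm_nonneg x]
      rw [quad]
      nlinarith
    have h3 := rpow_le_norm_rpow (sub_pos.2 hx') hq (show -1 - (n : ℝ) / 2 ≤ 0 by linarith)
    have h4 : 0 ≤ quad (‖x‖ ^ 2) (1 + t) x y ^ (-1 - (n : ℝ) / 2) :=
      Real.rpow_nonneg (le_trans (by positivity) hq) _
    rw [Real.norm_of_nonneg (by positivity)]
    have h5 : ‖x‖ ^ 2 ≤ 1 := pow_le_one₀ (norm_nonneg x) hx'.le
    have h6 : t * ‖x‖ ^ 2 * quad (‖x‖ ^ 2) (1 + t) x y ^ (-1 - (n : ℝ) / 2) ≤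
        t * 1 * (1 - ‖x‖) ^ (2 * (-1 - (n : ℝ) / 2)) := by gcongr
    calc _ ≤ (volume.real (unitBall n))⁻¹ * (t * 1 * (1 - ‖x‖) ^ (2 * (-1 - (n : ℝ) / 2))) := by
          gcongr
      _ = _ := by simp only [D]; ring
  · simp [hφ.eq_zero hy]

lemma IsTestFunction.gradient_eq_zero {Ω : Set (Rn n)} {φ : Rn n → ℝ} (hφ : IsTestFunction Ω φ)
    {y : Rn n} (hy : y ∉ Ω) : gradient φ y = 0 := by
  by_contra h
  exact hy (hφ.tsupport_subset (support_gradient_subset φ h))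

lemma IsTestFunction.continuous_gradient {Ω : Set (Rn n)} {φ : Rn n → ℝ}
    (hφ : IsTestFunction Ω φ) : Continuous (gradient φ) :=
  KatoDirichlet.continuous_gradient (hφ.contDiff.of_le (by exact_mod_cast le_top))

lemma IsTestFunction.hasCompactSupport_gradient {Ω : Set (Rn n)} {φ : Rn n → ℝ}
    (hφ : IsTestFunction Ω φ) : HasCompactSupport (gradient φ) :=
  KatoDirichlet.hasCompactSupport_gradient hφ.hasCompactSupport

/-- The reproducing formula `φ(x) = ∫ ∇_y G(x, y) · ∇φ(y) dy` for test functions. It follows from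
Green's identity for the regularized kernel, whose Laplacian is an approximation of `-δ_x`. -/
lemma IsTestFunction.eq_integral {φ : Rn n → ℝ} (hn : 3 ≤ n)
    (hφ : IsTestFunction (unitBall n) φ) {x : Rn n} (hx : x ∈ unitBall n) :
    φ x = ∫ y in unitBall n, inner ℝ (greenGrad 0 x y) (gradient φ y) := by
  have hn' : (3 : ℝ) ≤ n := by exact_mod_cast hn
  obtain ⟨M, hM⟩ := hφ.continuous_gradient.bounded_above_of_compact_support
    hφ.hasCompactSupport_gradient
  have hP : rieszPot (fun y => ‖gradient φ y‖ₑ) x ≠ ⊤ := by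
    refine rieszPot_ne_top_of_bounded hn (M := M.toNNReal) (fun y => ?_) hx
    rw [← ofReal_norm]
    exact ENNReal.ofReal_le_ofReal (hM y)
  have h1 := tendsto_integral_inner_greenGrad hn (norm_le_one_of_mem hx)
    hφ.continuous_gradient.aestronglyMeasurable hP
  have h2 : Tendsto (fun c : ℝ => (c ^ 2)⁻¹) atTop (𝓝[>] 0) :=
    (tendsto_inv_atTop_nhdsGT_zero).comp (tendsto_pow_atTop two_ne_zero)
  have h3 := (tendsto_integral_quad_one_mul hn hφ.contDiff.continuous hφ.hasCompactSupport x).sub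
    ((tendsto_integral_quad_normSq_mul hn hφ hx).comp h2)
  rw [sub_zero] at h3
  refine tendsto_nhds_unique (h3.congr' ?_) (h1.comp h2)
  filter_upwards [eventually_gt_atTop 0] with c hc
  simp only [Function.comp]
  have ht : 0 < (c ^ 2)⁻¹ := by positivity
  have i1 : Integrable fun y => (volume.real (unitBall n))⁻¹ *
      ((c ^ 2)⁻¹ * quad 1 (‖x‖ ^ 2 + (c ^ 2)⁻¹) x y ^ (-1 - (n : ℝ) / 2)) * φ y := by
    refine Continuous.integrable_of_hasCompactSupport ?_ hφ.hasCompactSupport.mul_left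
    refine Continuous.mul (continuous_const.mul (continuous_const.mul ?_)) hφ.contDiff.continuous
    exact (continuous_quad _ _ _).rpow_const fun y => Or.inl (quad_one_pos_of_pos ht x y).ne'
  have i2 : Integrable fun y => (volume.real (unitBall n))⁻¹ *
      ((c ^ 2)⁻¹ * ‖x‖ ^ 2 * quad (‖x‖ ^ 2) (1 + (c ^ 2)⁻¹) x y ^ (-1 - (n : ℝ) / 2)) * φ y := by
    refine Continuous.integrable_of_hasCompactSupport ?_ hφ.hasCompactSupport.mul_left
    refine Continuous.mul (continuous_const.mul (continuous_const.mul ?_)) hφ.contDiff.continuous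
    exact (continuous_quad _ _ _).rpow_const fun y => Or.inl (quad_normSq_pos_of_pos ht x y).ne'
  have h4 := integral_inner_gradient_gradient (contDiff_green ht x)
    (hφ.contDiff.of_le (by exact_mod_cast le_top)) hφ.hasCompactSupport volume
  rw [gradient_green hn ht] at h4
  rw [setIntegral_eq_integral_of_forall_compl_eq_zero
    (fun y hy => by rw [hφ.gradient_eq_zero hy, inner_zero_right]), h4, ← integral_sub i1 i2,
    ← integral_neg]
  refine integral_congr_ae (Eventually.of_forall fun y => ?_)
  simp only [laplacian_green hn ht]
  ring

/-! ### Pairings in `L²` -/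

section L2

variable {α : Type*} [MeasurableSpace α] {μ : Measure α} {F : Type*} [NormedAddCommGroup F]

lemma eLpNorm_two_sq (f : α → F) : eLpNorm f 2 μ ^ 2 = ∫⁻ y, ‖f y‖ₑ ^ 2 ∂μ := by
  have h := eLpNorm_nnreal_pow_eq_lintegral (μ := μ) (f := f) (p := 2) two_ne_zero
  simpa using h

lemma eLpNorm_two_le {f : α → F} {S : ℝ≥0∞} (h : ∫⁻ y, ‖f y‖ₑ ^ 2 ∂μ ≤ S ^ 2) :
    eLpNorm f 2 μ ≤ S := by
  rw [← eLpNorm_two_sq] at h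
  exact (ENNReal.pow_le_pow_left_iff two_ne_zero).1 h

lemma tendsto_eLpNorm_two_of_bounded [IsFiniteMeasure μ] {f : ℕ → α → F} {M : ℝ}
    (hf : ∀ k, AEStronglyMeasurable (f k) μ) (hM : ∀ k, ∀ᵐ y ∂μ, ‖f k y‖ ≤ M)
    (hlim : ∀ᵐ y ∂μ, Tendsto (fun k => f k y) atTop (𝓝 0)) :
    Tendsto (fun k => eLpNorm (f k) 2 μ) atTop (𝓝 0) := by
  have h : Tendsto (fun k => ∫⁻ y, ‖f k y‖ₑ ^ 2 ∂μ) atTop (𝓝 (∫⁻ _, 0 ∂μ)) := by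
    refine tendsto_lintegral_of_dominated_convergence' (fun _ => ENNReal.ofReal M ^ 2)
      (fun k => (hf k).enorm.pow_const 2) (fun k => ?_) ?_ ?_
    · filter_upwards [hM k] with y hy
      rw [← ofReal_norm]
      exact pow_le_pow_left' (ENNReal.ofReal_le_ofReal hy) 2
    · rw [lintegral_const]
      exact ENNReal.mul_ne_top (by simp) (measure_ne_top _ _)
    · filter_upwards [hlim] with y hy
      have := (ENNReal.continuous_pow 2).continuousAt.tendsto.comp hy.enorm
      simpa [Function.comp_def] using this
  rw [lintegral_zero] at h
  have h2 := (ENNReal.continuous_rpow_const (y := (1 / 2 : ℝ))).continuousAt.tendsto.comp h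
  rw [ENNReal.zero_rpow_of_pos (by norm_num)] at h2
  refine h2.congr fun k => ?_
  simp only [Function.comp, ← eLpNorm_two_sq]
  rw [← ENNReal.rpow_natCast, ← ENNReal.rpow_mul]
  norm_num

variable [InnerProductSpace ℝ F]

lemma integrable_inner_of_memLp {f g : α → F} (hf : MemLp f 2 μ) (hg : MemLp g 2 μ) :
    Integrable (fun y => inner ℝ (f y) (g y)) μ :=
  (hf.norm.integrable_mul hg.norm).mono' (hf.1.inner hg.1)
    (Eventually.of_forall fun _ => norm_inner_le_norm _ _)

lemma tendsto_integral_inner_of_tendsto_eLpNorm {p f : α → F} {g : ℕ → α → F} (hp : MemLp p 2 μ)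
    (hf : MemLp f 2 μ) (hg : ∀ k, MemLp (g k) 2 μ)
    (h : Tendsto (fun k => eLpNorm (fun y => g k y - f y) 2 μ) atTop (𝓝 0)) :
    Tendsto (fun k => ∫ y, inner ℝ (p y) (g k y) ∂μ) atTop (𝓝 (∫ y, inner ℝ (p y) (f y) ∂μ)) := by
  refine tendsto_integral_of_L1' _ (hp.1.inner hf.1)
    (Eventually.of_forall fun k => integrable_inner_of_memLp hp (hg k)) ?_
  have h1 : Tendsto (fun k => eLpNorm p 2 μ * eLpNorm (fun y => g k y - f y) 2 μ) atTop (𝓝 0) := by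
    have := ENNReal.Tendsto.const_mul h (Or.inr hp.2.ne)
    rwa [mul_zero] at this
  refine tendsto_of_tendsto_of_tendsto_of_le_of_le tendsto_const_nhds h1 (fun _ => zero_le)
    fun k => ?_
  have h2 := eLpNorm_le_eLpNorm_mul_eLpNorm_of_nnnorm (p := 2) (q := 2) (r := 1) hp.1
    ((hg k).1.sub hf.1) (fun a b => inner ℝ a b) 1
    (Eventually.of_forall fun y => by
      rw [one_mul]; exact nnnorm_inner_le_nnnorm _ _)
  rw [ENNReal.coe_one, one_mul] at h2
  refine le_trans (le_of_eq ?_) h2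
  congr 1
  ext y
  simp [inner_sub_right]

end L2

/-! ### Test functions and `W₀^{1,2}` -/

lemma gradient_sub_eq {u v : Rn n → ℝ} {y : Rn n} (hu : DifferentiableAt ℝ u y)
    (hv : DifferentiableAt ℝ v y) :
    gradient (fun z => u z - v z) y = gradient u y - gradient v y := by
  have h : HasFDerivAt (fun z => u z - v z) _ y := hu.hasFDerivAt.sub hv.hasFDerivAt
  rw [gradient, h.fderiv, map_sub]; rfl

lemma IsTestFunction.differentiable {Ω : Set (Rn n)} {φ : Rn n → ℝ} (hφ : IsTestFunction Ω φ) :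
    Differentiable ℝ φ := hφ.contDiff.differentiable (by simp)

lemma IsTestFunction.sub {Ω : Set (Rn n)} {φ ψ : Rn n → ℝ} (hφ : IsTestFunction Ω φ)
    (hψ : IsTestFunction Ω ψ) : IsTestFunction Ω (fun y => φ y - ψ y) where
  contDiff := hφ.contDiff.sub hψ.contDiff
  hasCompactSupport := hφ.hasCompactSupport.sub hψ.hasCompactSupport
  tsupport_subset := (tsupport_sub φ ψ).trans (union_subset hφ.tsupport_subset hψ.tsupport_subset)

lemma IsTestFunction.const_mul {Ω : Set (Rn n)} {φ : Rn n → ℝ} (hφ : IsTestFunction Ω φ)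
    (c : ℝ) : IsTestFunction Ω (fun y => c * φ y) where
  contDiff := contDiff_const.mul hφ.contDiff
  hasCompactSupport := hφ.hasCompactSupport.mul_left
  tsupport_subset := (tsupport_mul_subset_right).trans hφ.tsupport_subset

lemma IsTestFunction.zero (Ω : Set (Rn n)) : IsTestFunction Ω (fun _ => 0) where
  contDiff := contDiff_const
  hasCompactSupport := HasCompactSupport.zero
  tsupport_subset := by
    rw [show (fun _ : Rn n => (0 : ℝ)) = 0 from rfl, tsupport_eq_empty_iff.2 rfl]
    exact empty_subset _

lemma IsTestFunction.memLp {Ω : Set (Rn n)} {φ : Rn n → ℝ} (hφ : IsTestFunction Ω φ)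
    {μ : Measure (Rn n)} [IsFiniteMeasureOnCompacts μ] : MemLp φ 2 μ :=
  hφ.contDiff.continuous.memLp_of_hasCompactSupport hφ.hasCompactSupport

lemma IsTestFunction.memLp_gradient {Ω : Set (Rn n)} {φ : Rn n → ℝ} (hφ : IsTestFunction Ω φ)
    {μ : Measure (Rn n)} [IsFiniteMeasureOnCompacts μ] : MemLp (gradient φ) 2 μ :=
  hφ.continuous_gradient.memLp_of_hasCompactSupport hφ.hasCompactSupport_gradient

/-- Integration by parts in the direction `e`, written with inner products of `L²` functions. -/
lemma IsTestFunction.integral_mul_inner_gradient {Ω : Set (Rn n)} {φ ψ : Rn n → ℝ}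
    (hφ : IsTestFunction Ω φ) (hψ : IsTestFunction Ω ψ) (e : Rn n) :
    ∫ y in Ω, inner ℝ (inner ℝ e (gradient ψ y)) (φ y) =
      - ∫ y in Ω, inner ℝ (ψ y • e) (gradient φ y) := by
  have h1 {φ : Rn n → ℝ} (hφ : IsTestFunction Ω φ) : Continuous fun y => fderiv ℝ φ y e :=
    ((hφ.contDiff.of_le (m := 1) (by exact_mod_cast le_top)).continuous_fderiv
      one_ne_zero).clm_apply continuous_const
  rw [setIntegral_eq_integral_of_forall_compl_eq_zero
      (fun y hy => by rw [hφ.eq_zero hy, inner_zero_right]),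
    setIntegral_eq_integral_of_forall_compl_eq_zero
      (fun y hy => by rw [hψ.eq_zero hy, zero_smul, inner_zero_left])]
  have h2 := integral_mul_fderiv_eq_neg_fderiv_mul_of_integrable (μ := (volume : Measure (Rn n)))
    (f := φ) (g := ψ) (v := e)
    (((h1 hφ).mul hψ.contDiff.continuous).integrable_of_hasCompactSupport
      hψ.hasCompactSupport.mul_left)
    ((hφ.contDiff.continuous.mul (h1 hψ)).integrable_of_hasCompactSupport
      hφ.hasCompactSupport.mul_right)
    ((hφ.contDiff.continuous.mul hψ.contDiff.continuous).integrable_of_hasCompactSupport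
      hψ.hasCompactSupport.mul_left)
    (fun y _ => hφ.differentiable y) (fun y _ => hψ.differentiable y)
  calc _ = ∫ y, φ y * fderiv ℝ ψ y e := by
        refine integral_congr_ae (Eventually.of_forall fun y => ?_)
        simp
    _ = _ := h2
    _ = _ := by
        congr 1
        refine integral_congr_ae (Eventually.of_forall fun y => ?_)
        simp [mul_comm]

/-- Membership in `W₀^{1,2}` only requires the approximation by test functions: the weak gradient
condition passes to the limit. -/
lemma isW012_of_approx {Ω : Set (Rn n)} {u : Rn n → ℝ} {Du : Rn n → Rn n}
    (hu : MemLp u 2 (volume.restrict Ω)) (hDu : MemLp Du 2 (volume.restrict Ω))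
    {φ : ℕ → Rn n → ℝ} (hφ : ∀ k, IsTestFunction Ω (φ k))
    (h1 : Tendsto (fun k => eLpNorm (fun y => φ k y - u y) 2 (volume.restrict Ω)) atTop (𝓝 0))
    (h2 : Tendsto (fun k => eLpNorm (fun y => gradient (φ k) y - Du y) 2 (volume.restrict Ω))
      atTop (𝓝 0)) : IsW012 Ω u Du := by
  refine ⟨⟨hu, hDu, fun ψ hψ => ?_⟩, φ, hφ, h1, h2⟩
  have i1 : Integrable (fun y => u y • gradient ψ y) (volume.restrict Ω) :=
    (hu.norm.integrable_mul hψ.memLp_gradient.norm).mono'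
      (hu.1.smul hψ.memLp_gradient.1) (Eventually.of_forall fun _ => (norm_smul _ _).le)
  have i2 : Integrable (fun y => ψ y • Du y) (volume.restrict Ω) :=
    ((hψ.memLp (μ := volume.restrict Ω)).norm.integrable_mul hDu.norm).mono'
      (hψ.memLp.1.smul hDu.1) (Eventually.of_forall fun _ => (norm_smul _ _).le)
  refine ext_inner_left ℝ fun e => ?_
  rw [inner_neg_right, ← integral_inner i1, ← integral_inner i2]
  have m1 : MemLp (fun y => inner ℝ e (gradient ψ y)) 2 (volume.restrict Ω) :=
    hψ.memLp_gradient.const_inner e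
  have m2 : MemLp (fun y => ψ y • e) 2 (volume.restrict Ω) :=
    (hψ.contDiff.continuous.smul continuous_const).memLp_of_hasCompactSupport
      hψ.hasCompactSupport.smul_right
  have t1 := tendsto_integral_inner_of_tendsto_eLpNorm m1 hu (fun k => (hφ k).memLp) h1
  have t2 := (tendsto_integral_inner_of_tendsto_eLpNorm m2 hDu
    (fun k => (hφ k).memLp_gradient) h2).neg
  have t3 := tendsto_nhds_unique t1
    (t2.congr fun k => ((hφ k).integral_mul_inner_gradient hψ e).symm)
  calc _ = ∫ y in Ω, inner ℝ (inner ℝ e (gradient ψ y)) (u y) := by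
        refine integral_congr_ae (Eventually.of_forall fun y => ?_)
        simp [real_inner_smul_right]
    _ = _ := t3
    _ = _ := by
        congr 1
        refine integral_congr_ae (Eventually.of_forall fun y => ?_)
        simp [real_inner_smul_left, real_inner_smul_right]

lemma IsW012.congr_ae {Ω : Set (Rn n)} {u v : Rn n → ℝ} {Du : Rn n → Rn n}
    (h : IsW012 Ω u Du) (huv : u =ᵐ[volume.restrict Ω] v) : IsW012 Ω v Du := by
  obtain ⟨φ, hφ, h1, h2⟩ := h.approx
  refine isW012_of_approx (h.isW12.memLp.ae_eq huv) h.isW12.memLp_grad hφ (h1.congr fun k => ?_) h2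
  refine eLpNorm_congr_ae ?_
  filter_upwards [huv] with y hy
  rw [hy]

lemma IsW012.sub {Ω : Set (Rn n)} {u v : Rn n → ℝ} {Du Dv : Rn n → Rn n}
    (hu : IsW012 Ω u Du) (hv : IsW012 Ω v Dv) :
    IsW012 Ω (fun y => u y - v y) (fun y => Du y - Dv y) := by
  obtain ⟨φ, hφ, h1, h2⟩ := hu.approx
  obtain ⟨ψ, hψ, h3, h4⟩ := hv.approx
  refine isW012_of_approx (hu.isW12.memLp.sub hv.isW12.memLp)
    (hu.isW12.memLp_grad.sub hv.isW12.memLp_grad) (fun k => (hφ k).sub (hψ k)) ?_ ?_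
  · have h := h1.add h3
    rw [add_zero] at h
    refine tendsto_of_tendsto_of_tendsto_of_le_of_le tendsto_const_nhds h (fun _ => zero_le)
      fun k => ?_
    refine le_trans (le_of_eq ?_) (eLpNorm_sub_le ((hφ k).memLp.1.sub hu.isW12.memLp.1)
      ((hψ k).memLp.1.sub hv.isW12.memLp.1) one_le_two)
    congr 1
    ext y
    simp; ring
  · have h := h2.add h4
    rw [add_zero] at h
    refine tendsto_of_tendsto_of_tendsto_of_le_of_le tendsto_const_nhds h (fun _ => zero_le)
      fun k => ?_
    refine le_trans (le_of_eq ?_) (eLpNorm_sub_le ((hφ k).memLp_gradient.1.sub hu.isW12.memLp_grad.1)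
      ((hψ k).memLp_gradient.1.sub hv.isW12.memLp_grad.1) one_le_two)
    congr 1
    ext1 y
    simp only [Pi.sub_apply]
    rw [gradient_sub_eq ((hφ k).differentiable y) ((hψ k).differentiable y)]
    abel

/-! ### Smooth functions vanishing on the sphere -/

lemma exists_deriv_smoothTransition_le : ∃ M : ℝ, ∀ s, |deriv Real.smoothTransition s| ≤ M := by
  have hc : Continuous (deriv Real.smoothTransition) :=
    (Real.smoothTransition.contDiff (n := 1)).continuous_deriv le_rfl
  obtain ⟨M, hM⟩ := (isCompact_Icc (a := (0 : ℝ)) (b := 1)).exists_bound_of_continuousOn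
    hc.continuousOn
  refine ⟨max M 0, fun s => ?_⟩
  by_cases hs : s ∈ Icc (0 : ℝ) 1
  · exact (hM s hs).trans (le_max_left _ _)
  · have : deriv Real.smoothTransition s = 0 := by
      rw [mem_Icc, not_and_or, not_le, not_le] at hs
      rcases hs with hs | hs
      · have : Real.smoothTransition =ᶠ[𝓝 s] fun _ => 0 := by
          filter_upwards [gt_mem_nhds hs] with r hr using
            Real.smoothTransition.zero_of_nonpos hr.le
        rw [this.deriv_eq, deriv_const]
      · have : Real.smoothTransition =ᶠ[𝓝 s] fun _ => 1 := by
          filter_upwards [lt_mem_nhds hs] with r hr using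
            Real.smoothTransition.one_of_one_le hr.le
        rw [this.deriv_eq, deriv_const]
    rw [this, abs_zero]
    exact le_max_right _ _

/-- The cutoff function `χ(k (1 - |y|²) - 1)`, which vanishes near the sphere and tends to `1` in
the ball as `k → ∞`. -/
def cutoff (k : ℝ) (y : Rn n) : ℝ := Real.smoothTransition (k * (1 - ‖y‖ ^ 2) - 1)

lemma contDiff_cutoff (k : ℝ) : ContDiff ℝ ∞ (cutoff (n := n) k) := by
  have : ContDiff ℝ ∞ fun y : Rn n => k * (1 - ‖y‖ ^ 2) - 1 :=
    (contDiff_const.mul (contDiff_const.sub (contDiff_norm_sq ℝ))).sub contDiff_const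
  exact (Real.smoothTransition.contDiff (n := ⊤)).comp this

lemma fderiv_cutoff (k : ℝ) (y : Rn n) : fderiv ℝ (cutoff k) y =
    (deriv Real.smoothTransition (k * (1 - ‖y‖ ^ 2) - 1) * (-2 * k)) • innerSL ℝ y := by
  have h1 : HasFDerivAt (fun y : Rn n => ‖y‖ ^ 2) (2 • innerSL ℝ y) y :=
    (hasStrictFDerivAt_norm_sq y).hasFDerivAt
  have h2 := ((h1.const_sub 1).const_mul k).sub_const 1
  have h3 : HasDerivAt Real.smoothTransition
      (deriv Real.smoothTransition (k * (1 - ‖y‖ ^ 2) - 1)) (k * (1 - ‖y‖ ^ 2) - 1) :=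
    ((Real.smoothTransition.contDiff (n := 1)).differentiable one_ne_zero _).hasDerivAt
  have h4 := h3.comp_hasFDerivAt y h2
  rw [show fderiv ℝ (cutoff k) y = _ from h4.fderiv]
  ext z
  simp
  ring

lemma cutoff_eq_zero {k : ℝ} {y : Rn n} (h : k * (1 - ‖y‖ ^ 2) ≤ 1) : cutoff k y = 0 :=
  Real.smoothTransition.zero_of_nonpos (by linarith)

lemma cutoff_eq_one {k : ℝ} {y : Rn n} (h : 2 ≤ k * (1 - ‖y‖ ^ 2)) : cutoff k y = 1 :=
  Real.smoothTransition.one_of_one_le (by linarith)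

lemma fderiv_cutoff_eq_zero {k : ℝ} {y : Rn n} (h : 2 < k * (1 - ‖y‖ ^ 2)) :
    fderiv ℝ (cutoff k) y = 0 := by
  have : cutoff k =ᶠ[𝓝 y] fun _ => 1 := by
    have hc : Continuous fun y : Rn n => k * (1 - ‖y‖ ^ 2) := by fun_prop
    filter_upwards [hc.continuousAt.eventually (lt_mem_nhds h)] with z hz
    exact cutoff_eq_one (le_of_lt hz)
  rw [this.fderiv_eq, fderiv_fun_const]; rfl

lemma isTestFunction_cutoff_mul {k : ℝ} (hk : 0 < k) {w : Rn n → ℝ} (hw : ContDiff ℝ ∞ w) :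
    IsTestFunction (unitBall n) fun y => cutoff k y * w y := by
  have hcl : IsClosed {y : Rn n | 1 ≤ k * (1 - ‖y‖ ^ 2)} :=
    isClosed_le continuous_const (by fun_prop)
  have hsub : {y : Rn n | 1 ≤ k * (1 - ‖y‖ ^ 2)} ⊆ unitBall n := by
    intro y hy
    rw [mem_unitBall]
    by_contra h
    have : 1 ≤ ‖y‖ ^ 2 := one_le_pow₀ (not_lt.1 h)
    have hy' : 1 ≤ k * (1 - ‖y‖ ^ 2) := hy
    nlinarith
  have hts : tsupport (fun y => cutoff k y * w y) ⊆ {y : Rn n | 1 ≤ k * (1 - ‖y‖ ^ 2)} := by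
    refine closure_minimal (fun y hy => ?_) hcl
    by_contra h
    exact hy (by simp only [cutoff_eq_zero (le_of_lt (not_le.1 h)), zero_mul])
  refine ⟨(contDiff_cutoff k).mul hw, ?_, hts.trans hsub⟩
  refine HasCompactSupport.of_support_subset_isCompact (isCompact_closedBall (0 : Rn n) 1)
    ((subset_tsupport _).trans (hts.trans (hsub.trans Metric.ball_subset_closedBall)))

lemma abs_le_of_eq_zero_on_sphere {w : Rn n → ℝ} (hw : ContDiff ℝ ∞ w)
    (h0 : ∀ y : Rn n, ‖y‖ = 1 → w y = 0) {L : ℝ}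
    (hL : ∀ y ∈ Metric.closedBall (0 : Rn n) 1, ‖fderiv ℝ w y‖ ≤ L) {y : Rn n} (hy0 : y ≠ 0)
    (hy : ‖y‖ ≤ 1) : |w y| ≤ L * (1 - ‖y‖) := by
  have hp : 0 < ‖y‖ := norm_pos_iff.2 hy0
  have hz : ‖‖y‖⁻¹ • y‖ = 1 := by rw [norm_smul, norm_inv, norm_norm, inv_mul_cancel₀ hp.ne']
  have h := Convex.norm_image_sub_le_of_norm_fderiv_le
    (fun x _ => (hw.differentiable (by simp)) x) hL (convex_closedBall (0 : Rn n) 1)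
    (mem_closedBall_zero_iff.2 hz.le) (mem_closedBall_zero_iff.2 hy)
  rw [h0 _ hz, sub_zero, Real.norm_eq_abs] at h
  refine h.trans_eq ?_
  congr 1
  calc ‖y - ‖y‖⁻¹ • y‖ = ‖(1 - ‖y‖⁻¹) • y‖ := by rw [sub_smul, one_smul]
    _ = |1 - ‖y‖⁻¹| * ‖y‖ := norm_smul _ _
    _ = 1 - ‖y‖ := by
        rw [abs_of_nonpos (by rw [sub_nonpos]; exact (one_le_inv₀ hp).2 hy)]
        field_simp
        ring

/-- A smooth function that vanishes on the unit sphere belongs to `W₀^{1,2}(B₁)`. Multiplication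
by the cutoff creates the term `w ∇χ_k`, which is bounded since `|w| = O(1/k)` where `∇χ_k` is of
order `k`. -/
lemma isW012_of_contDiff {w : Rn n → ℝ} (hw : ContDiff ℝ ∞ w)
    (h0 : ∀ y : Rn n, ‖y‖ = 1 → w y = 0) : IsW012 (unitBall n) w (gradient w) := by
  have hK : IsCompact (Metric.closedBall (0 : Rn n) 1) := isCompact_closedBall _ _
  have hwc := hw.continuous
  have hdc : Continuous (fderiv ℝ w) := hw.continuous_fderiv (by simp)
  have hgc : Continuous (gradient w) := continuous_gradient (hw.of_le (by exact_mod_cast le_top))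
  obtain ⟨W, hW⟩ := hK.exists_bound_of_continuousOn hwc.continuousOn
  obtain ⟨L, hL⟩ := hK.exists_bound_of_continuousOn hdc.continuousOn
  obtain ⟨M, hM⟩ := exists_deriv_smoothTransition_le
  have hL0 : 0 ≤ L := (norm_nonneg _).trans (hL 0 (by simp))
  have hM0 : 0 ≤ M := (abs_nonneg _).trans (hM 0)
  have hW0 : 0 ≤ W := (norm_nonneg _).trans (hW 0 (by simp))
  have hgn (v : Rn n → ℝ) (y : Rn n) : ‖gradient v y‖ = ‖fderiv ℝ v y‖ := by
    rw [gradient, LinearIsometryEquiv.norm_map]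
  have memb {F : Type} [NormedAddCommGroup F] {f : Rn n → F} {S : ℝ}
      (hf : AEStronglyMeasurable f (volume.restrict (unitBall n)))
      (hS : ∀ y ∈ Metric.closedBall (0 : Rn n) 1, ‖f y‖ ≤ S) :
      MemLp f 2 (volume.restrict (unitBall n)) :=
    MemLp.of_bound hf S (by
      filter_upwards [ae_restrict_mem (measurableSet_unitBall n)] with y hy
        using hS y (Metric.ball_subset_closedBall hy))
  have hk (k : ℕ) : (0 : ℝ) < k + 3 := by positivity
  have hT (k : ℕ) := isTestFunction_cutoff_mul (hk k) hw
  -- inside the ball the cutoff is eventually equal to one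
  have hev (y : Rn n) (hy : y ∈ unitBall n) :
      ∀ᶠ k : ℕ in atTop, 2 < ((k : ℝ) + 3) * (1 - ‖y‖ ^ 2) := by
    have hy' := mem_unitBall.1 hy
    have h1 : 0 < 1 - ‖y‖ ^ 2 := by nlinarith [norm_nonneg y]
    have : Tendsto (fun k : ℕ => ((k : ℝ) + 3) * (1 - ‖y‖ ^ 2)) atTop atTop :=
      (tendsto_atTop_add_const_right _ _ tendsto_natCast_atTop_atTop).atTop_mul_const h1
    exact this.eventually_gt_atTop 2
  have hfd (k : ℕ) (y : Rn n) : fderiv ℝ (fun y => cutoff ((k : ℝ) + 3) y * w y) y =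
      cutoff ((k : ℝ) + 3) y • fderiv ℝ w y + w y • fderiv ℝ (cutoff ((k : ℝ) + 3)) y := by
    exact fderiv_mul ((contDiff_cutoff _).differentiable (by simp) y)
      (hw.differentiable (by simp) y)
  have hc0 (k : ℝ) (y : Rn n) : 0 ≤ cutoff k y := Real.smoothTransition.nonneg _
  have hc1 (k : ℝ) (y : Rn n) : cutoff k y ≤ 1 := Real.smoothTransition.le_one _
  refine isW012_of_approx (memb hwc.aestronglyMeasurable hW)
    (memb hgc.aestronglyMeasurable fun y hy => (hgn w y).trans_le (hL y hy)) hT ?_ ?_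
  · refine tendsto_eLpNorm_two_of_bounded (M := W) (fun k => ?_) (fun k => ?_) ?_
    · exact ((hT k).contDiff.continuous.sub hwc).aestronglyMeasurable
    · filter_upwards [ae_restrict_mem (measurableSet_unitBall n)] with y hy
      have e : cutoff ((k : ℝ) + 3) y * w y - w y = -((1 - cutoff ((k : ℝ) + 3) y) * w y) := by ring
      rw [e, norm_neg, norm_mul, Real.norm_of_nonneg (sub_nonneg.2 (hc1 _ _))]
      have := hW y (Metric.ball_subset_closedBall hy)
      nlinarith [hc0 ((k : ℝ) + 3) y, norm_nonneg (w y)]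
    · filter_upwards [ae_restrict_mem (measurableSet_unitBall n)] with y hy
      refine tendsto_const_nhds.congr' ?_
      filter_upwards [hev y hy] with k hk
      rw [cutoff_eq_one hk.le]; ring
  · refine tendsto_eLpNorm_two_of_bounded (M := L + L * (4 * M)) (fun k => ?_) (fun k => ?_) ?_
    · exact ((hT k).continuous_gradient.sub hgc).aestronglyMeasurable
    · filter_upwards [ae_restrict_mem (measurableSet_unitBall n)] with y hy
      have hyc := Metric.ball_subset_closedBall hy
      have hy1 := norm_le_one_of_mem hy
      rw [gradient, gradient, ← map_sub, LinearIsometryEquiv.norm_map, hfd]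
      set κ : ℝ := (k : ℝ) + 3 with hκ
      have hκ3 : 3 ≤ κ := by rw [hκ]; linarith [(Nat.cast_nonneg k : (0 : ℝ) ≤ k)]
      have e : cutoff κ y • fderiv ℝ w y + w y • fderiv ℝ (cutoff κ) y - fderiv ℝ w y =
          -((1 - cutoff κ y) • fderiv ℝ w y) + w y • fderiv ℝ (cutoff κ) y := by
        rw [sub_smul, one_smul]; abel
      rw [e]
      refine (norm_add_le _ _).trans (add_le_add ?_ ?_)
      · rw [norm_neg, norm_smul, Real.norm_of_nonneg (sub_nonneg.2 (hc1 _ _))]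
        have := hL y hyc
        nlinarith [hc0 κ y, norm_nonneg (fderiv ℝ w y)]
      · rw [norm_smul]
        by_cases h2 : 2 < κ * (1 - ‖y‖ ^ 2)
        · rw [fderiv_cutoff_eq_zero h2, norm_zero, mul_zero]; positivity
        · rw [not_lt] at h2
          have hy0 : y ≠ 0 := by
            rintro rfl
            rw [norm_zero] at h2
            linarith
          have h3 := abs_le_of_eq_zero_on_sphere hw h0 hL hy0 hy1
          rw [fderiv_cutoff, norm_smul, norm_mul, innerSL_apply_norm, Real.norm_eq_abs,
            Real.norm_eq_abs, Real.norm_eq_abs, abs_mul, abs_of_pos (by linarith : 0 < κ)]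
          have h4 : |w y| * κ ≤ L * 2 := by
            have : (1 - ‖y‖) * κ ≤ 2 := by nlinarith [norm_nonneg y]
            nlinarith
          have h5 := hM (κ * (1 - ‖y‖ ^ 2) - 1)
          have h6 : |(-2 : ℝ)| = 2 := by norm_num
          rw [h6]
          calc |w y| * (|deriv Real.smoothTransition (κ * (1 - ‖y‖ ^ 2) - 1)| * (2 * κ) * ‖y‖)
              = (|w y| * κ) * |deriv Real.smoothTransition (κ * (1 - ‖y‖ ^ 2) - 1)| *
                (2 * ‖y‖) := by ring
            _ ≤ (L * 2) * M * (2 * 1) := by gcongr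
            _ = _ := by ring
    · filter_upwards [ae_restrict_mem (measurableSet_unitBall n)] with y hy
      refine tendsto_const_nhds.congr' ?_
      filter_upwards [hev y hy] with k hk
      rw [gradient, gradient, ← map_sub, hfd, cutoff_eq_one hk.le, fderiv_cutoff_eq_zero hk]
      simp

lemma isW012_green (hn : 3 ≤ n) {t : ℝ} (ht : 0 < t) (x : Rn n) :
    IsW012 (unitBall n) (green t x) (greenGrad t x) := by
  rw [← gradient_green hn ht]
  exact isW012_of_contDiff (contDiff_green ht x) fun y hy => green_eq_zero_right x hy

/-! ### The reproducing operator on `L²` vector fields -/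

/-- The operator `D ↦ ∫_{B₁} ∇_y G(x, y) · D(y) dy`, which recovers a function of `W₀^{1,2}(B₁)`
from its weak gradient. -/
def greenPot (D : Rn n → Rn n) (x : Rn n) : ℝ :=
  ∫ y in unitBall n, inner ℝ (greenGrad 0 x y) (D y)

lemma aestronglyMeasurable_greenPot {D : Rn n → Rn n}
    (hD : AEStronglyMeasurable D (volume.restrict (unitBall n))) :
    AEStronglyMeasurable (greenPot D) (volume.restrict (unitBall n)) :=
  ((measurable_greenGrad 0).aestronglyMeasurable.inner hD.comp_snd :
    AEStronglyMeasurable (fun q : Rn n × Rn n => inner ℝ (greenGrad 0 q.1 q.2) (D q.2))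
      ((volume.restrict (unitBall n)).prod (volume.restrict (unitBall n)))).integral_prod_right'

lemma enorm_greenPot_le (hn : 3 ≤ n) {D : Rn n → Rn n}
    (hD : AEStronglyMeasurable D (volume.restrict (unitBall n))) {x : Rn n} (hx : ‖x‖ ≤ 1) :
    ‖greenPot D x‖ₑ ≤ kernelConst n * rieszPot (fun y => ‖D y‖ₑ) x :=
  (enorm_integral_le_lintegral_enorm _).trans
    (lintegral_enorm_inner_greenGrad_le hn le_rfl hx hD)

lemma exists_eLpNorm_greenPot_le (hn : 3 ≤ n) :
    ∃ C : ℝ≥0, ∀ D : Rn n → Rn n, AEStronglyMeasurable D (volume.restrict (unitBall n)) →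
      eLpNorm (greenPot D) 2 (volume.restrict (unitBall n)) ≤
        C * eLpNorm D 2 (volume.restrict (unitBall n)) := by
  obtain ⟨A, hA⟩ := exists_lintegral_rieszPot_sq_le hn
  refine ⟨kernelConst n * NNReal.sqrt A, fun D hD => eLpNorm_two_le ?_⟩
  calc ∫⁻ x in unitBall n, ‖greenPot D x‖ₑ ^ 2
      ≤ ∫⁻ x in unitBall n, (kernelConst n : ℝ≥0∞) ^ 2 * rieszPot (fun y => ‖D y‖ₑ) x ^ 2 := by
        refine setLIntegral_mono' (measurableSet_unitBall n) fun x hx => ?_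
        rw [← mul_pow]
        exact pow_le_pow_left' (enorm_greenPot_le hn hD (norm_le_one_of_mem hx)) 2
    _ = (kernelConst n : ℝ≥0∞) ^ 2 * ∫⁻ x in unitBall n, rieszPot (fun y => ‖D y‖ₑ) x ^ 2 :=
        lintegral_const_mul'' _ ((aemeasurable_rieszPot hD.enorm).pow_const 2)
    _ ≤ (kernelConst n : ℝ≥0∞) ^ 2 * (A * ∫⁻ y in unitBall n, ‖D y‖ₑ ^ 2) := by
        gcongr
        exact hA _ hD.enorm
    _ = _ := by
        rw [mul_pow, ← eLpNorm_two_sq, ENNReal.coe_mul, mul_pow, ← ENNReal.coe_pow (NNReal.sqrt A),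
          NNReal.sq_sqrt, mul_assoc]

lemma memLp_greenPot (hn : 3 ≤ n) {D : Rn n → Rn n}
    (hD : MemLp D 2 (volume.restrict (unitBall n))) :
    MemLp (greenPot D) 2 (volume.restrict (unitBall n)) := by
  obtain ⟨C, hC⟩ := exists_eLpNorm_greenPot_le hn
  exact ⟨aestronglyMeasurable_greenPot hD.1,
    (hC D hD.1).trans_lt (ENNReal.mul_lt_top ENNReal.coe_lt_top hD.2)⟩

lemma ae_rieszPot_ne_top (hn : 3 ≤ n) {D : Rn n → Rn n}
    (hD : MemLp D 2 (volume.restrict (unitBall n))) :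
    ∀ᵐ x ∂(volume.restrict (unitBall n)), rieszPot (fun y => ‖D y‖ₑ) x ≠ ⊤ := by
  obtain ⟨A, hA⟩ := exists_lintegral_rieszPot_sq_le hn
  have h : ∫⁻ x in unitBall n, rieszPot (fun y => ‖D y‖ₑ) x ^ 2 ≠ ⊤ := by
    refine ne_top_of_le_ne_top ?_ (hA _ hD.1.enorm)
    rw [← eLpNorm_two_sq]
    exact ENNReal.mul_ne_top ENNReal.coe_ne_top (ENNReal.pow_ne_top hD.2.ne)
  filter_upwards [ae_lt_top' ((aemeasurable_rieszPot hD.1.enorm).pow_const 2) h] with x hx h2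
  simp [h2] at hx

lemma greenPot_sub_ae (hn : 3 ≤ n) {D D' : Rn n → Rn n}
    (hD : MemLp D 2 (volume.restrict (unitBall n)))
    (hD' : MemLp D' 2 (volume.restrict (unitBall n))) :
    ∀ᵐ x ∂(volume.restrict (unitBall n)),
      greenPot (fun y => D y - D' y) x = greenPot D x - greenPot D' x := by
  filter_upwards [ae_rieszPot_ne_top hn hD, ae_rieszPot_ne_top hn hD',
    ae_restrict_mem (measurableSet_unitBall n)] with x h1 h2 hx
  have hx' := norm_le_one_of_mem hx
  rw [greenPot, greenPot, greenPot,
    ← integral_sub (integrableOn_inner_greenGrad hn le_rfl hx' hD.1 h1)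
      (integrableOn_inner_greenGrad hn le_rfl hx' hD'.1 h2)]
  simp_rw [inner_sub_right]

lemma greenPot_congr {D D' : Rn n → Rn n} (h : D =ᵐ[volume.restrict (unitBall n)] D') :
    greenPot D = greenPot D' := by
  ext x
  refine integral_congr_ae ?_
  filter_upwards [h] with y hy
  rw [hy]

lemma tendsto_eLpNorm_greenPot_sub (hn : 3 ≤ n) {D : Rn n → Rn n} {E : ℕ → Rn n → Rn n}
    (hD : MemLp D 2 (volume.restrict (unitBall n)))
    (hE : ∀ k, MemLp (E k) 2 (volume.restrict (unitBall n)))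
    (h : Tendsto (fun k => eLpNorm (fun y => E k y - D y) 2 (volume.restrict (unitBall n)))
      atTop (𝓝 0)) :
    Tendsto (fun k => eLpNorm (fun x => greenPot (E k) x - greenPot D x) 2
      (volume.restrict (unitBall n))) atTop (𝓝 0) := by
  obtain ⟨C, hC⟩ := exists_eLpNorm_greenPot_le hn
  have h1 : Tendsto (fun k => C * eLpNorm (fun y => E k y - D y) 2
      (volume.restrict (unitBall n))) atTop (𝓝 0) := by
    have := ENNReal.Tendsto.const_mul h (Or.inr (ENNReal.coe_ne_top (r := C)))
    rwa [mul_zero] at this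
  refine tendsto_of_tendsto_of_tendsto_of_le_of_le tendsto_const_nhds h1 (fun _ => zero_le)
    fun k => ?_
  refine le_trans (le_of_eq (eLpNorm_congr_ae ?_)) (hC _ ((hE k).1.sub hD.1))
  filter_upwards [greenPot_sub_ae hn (hE k) hD] with x hx using hx.symm

lemma IsTestFunction.ae_eq_greenPot (hn : 3 ≤ n) {φ : Rn n → ℝ}
    (hφ : IsTestFunction (unitBall n) φ) :
    φ =ᵐ[volume.restrict (unitBall n)] greenPot (gradient φ) := by
  filter_upwards [ae_restrict_mem (measurableSet_unitBall n)] with x hx using hφ.eq_integral hn hx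

/-- A function of `W₀^{1,2}(B₁)` is recovered from its weak gradient by the Green function. -/
lemma IsW012.ae_eq_greenPot (hn : 3 ≤ n) {u : Rn n → ℝ} {Du : Rn n → Rn n}
    (h : IsW012 (unitBall n) u Du) : u =ᵐ[volume.restrict (unitBall n)] greenPot Du := by
  obtain ⟨φ, hφ, h1, h2⟩ := h.approx
  have h3 := tendsto_eLpNorm_greenPot_sub hn h.isW12.memLp_grad (fun k => (hφ k).memLp_gradient) h2
  have hP := memLp_greenPot hn h.isW12.memLp_grad
  have h4 := h3.add h1
  rw [add_zero] at h4
  have h5 : eLpNorm (fun x => u x - greenPot Du x) 2 (volume.restrict (unitBall n)) ≤ 0 := by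
    refine ge_of_tendsto' h4 fun k => ?_
    have e : eLpNorm (fun x => greenPot (gradient (φ k)) x - greenPot Du x) 2
        (volume.restrict (unitBall n)) =
        eLpNorm (fun x => φ k x - greenPot Du x) 2 (volume.restrict (unitBall n)) := by
      refine eLpNorm_congr_ae ?_
      filter_upwards [(hφ k).ae_eq_greenPot hn] with x hx
      rw [hx]
    rw [e]
    refine le_trans (le_of_eq ?_) (eLpNorm_sub_le ((hφ k).memLp.1.sub hP.1)
      ((hφ k).memLp.1.sub h.isW12.memLp.1) one_le_two)
    congr 1
    ext x
    simp
  have h6 := (eLpNorm_eq_zero_iff (h.isW12.memLp.1.sub hP.1) two_ne_zero).1 (le_antisymm h5 zero_le)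
  filter_upwards [h6] with x hx
  exact sub_eq_zero.1 hx

/-- A limit of gradients of test functions is the gradient of a function of `W₀^{1,2}(B₁)`, namely
of its image under the reproducing operator. -/
lemma isW012_greenPot_of_tendsto (hn : 3 ≤ n) {D : Rn n → Rn n}
    (hD : MemLp D 2 (volume.restrict (unitBall n))) {φ : ℕ → Rn n → ℝ}
    (hφ : ∀ k, IsTestFunction (unitBall n) (φ k))
    (h : Tendsto (fun k => eLpNorm (fun y => gradient (φ k) y - D y) 2
      (volume.restrict (unitBall n))) atTop (𝓝 0)) :
    IsW012 (unitBall n) (greenPot D) D := by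
  refine isW012_of_approx (memLp_greenPot hn hD) hD hφ ?_ h
  refine (tendsto_eLpNorm_greenPot_sub hn hD (fun k => (hφ k).memLp_gradient) h).congr fun k => ?_
  refine eLpNorm_congr_ae ?_
  filter_upwards [(hφ k).ae_eq_greenPot hn] with x hx
  rw [hx]

/-! ### Projection onto gradients -/

/-- The gradients of test functions, as a subspace of `L²(Ω)ⁿ`. -/
def testGradients (Ω : Set (Rn n)) : Submodule ℝ (Lp (Rn n) 2 (volume.restrict Ω)) where
  carrier := {v | ∃ φ, IsTestFunction Ω φ ∧ v =ᵐ[volume.restrict Ω] gradient φ}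
  add_mem' := by
    rintro v w ⟨φ, hφ, hv⟩ ⟨ψ, hψ, hw⟩
    have hψ' := hψ.const_mul (-1)
    refine ⟨fun y => φ y - -1 * ψ y, hφ.sub hψ', ?_⟩
    filter_upwards [Lp.coeFn_add v w, hv, hw] with y h1 h2 h3
    have h4 : HasFDerivAt (fun y => -1 * ψ y) ((-1 : ℝ) • fderiv ℝ ψ y) y :=
      (hψ.differentiable y).hasFDerivAt.const_mul (-1)
    have h5 : gradient (fun y => -1 * ψ y) y = - gradient ψ y := by
      rw [gradient, h4.fderiv, map_smul, neg_one_smul]; rfl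
    rw [h1, Pi.add_apply, h2, h3, gradient_sub_eq (hφ.differentiable y) (hψ'.differentiable y), h5,
      sub_neg_eq_add]
  zero_mem' := by
    refine ⟨fun _ => 0, IsTestFunction.zero Ω, ?_⟩
    filter_upwards [Lp.coeFn_zero (Rn n) 2 (volume.restrict Ω)] with y h1
    rw [h1, gradient_fun_const]; rfl
  smul_mem' := by
    rintro c v ⟨φ, hφ, hv⟩
    refine ⟨fun y => c * φ y, hφ.const_mul c, ?_⟩
    filter_upwards [Lp.coeFn_smul c v, hv] with y h1 h2
    have h4 : HasFDerivAt (fun y => c * φ y) (c • fderiv ℝ φ y) y :=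
      (hφ.differentiable y).hasFDerivAt.const_mul c
    rw [h1, Pi.smul_apply, h2, gradient, gradient, h4.fderiv, map_smul]

/-- The orthogonal projection of an `L²` vector field onto the closure of the gradients of test
functions. -/
lemma exists_projection {f : Rn n → Rn n} (hf : MemLp f 2 (volume.restrict (unitBall n))) :
    ∃ (D : Rn n → Rn n) (φ : ℕ → Rn n → ℝ), MemLp D 2 (volume.restrict (unitBall n)) ∧
      (∀ k, IsTestFunction (unitBall n) (φ k)) ∧
      Tendsto (fun k => eLpNorm (fun y => gradient (φ k) y - D y) 2
        (volume.restrict (unitBall n))) atTop (𝓝 0) ∧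
      eLpNorm D 2 (volume.restrict (unitBall n)) ≤ eLpNorm f 2 (volume.restrict (unitBall n)) ∧
      ∀ ψ, IsTestFunction (unitBall n) ψ →
        ∫ y in unitBall n, inner ℝ (f y - D y) (gradient ψ y) = 0 := by
  set S := (testGradients (unitBall n)).topologicalClosure
  set F := hf.toLp f
  set P := S.starProjection F
  have hP : P ∈ closure (testGradients (unitBall n) : Set (Lp (Rn n) 2 _)) :=
    S.starProjection_apply_mem F
  obtain ⟨v, hv, hlim⟩ := mem_closure_iff_seq_limit.1 hP
  choose φ hφ hvφ using hv
  refine ⟨P, φ, Lp.memLp P, hφ, ?_, ?_, fun ψ hψ => ?_⟩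
  · rw [Lp.tendsto_Lp_iff_tendsto_eLpNorm'] at hlim
    refine hlim.congr fun k => eLpNorm_congr_ae ?_
    filter_upwards [hvφ k] with y hy
    rw [Pi.sub_apply, hy]
  · have h := S.norm_starProjection_apply_le F
    rw [Lp.norm_def, Lp.norm_def, ENNReal.toReal_le_toReal (Lp.eLpNorm_ne_top _)
      (Lp.eLpNorm_ne_top _)] at h
    exact h.trans_eq (eLpNorm_congr_ae hf.coeFn_toLp)
  · set Ψ := (hψ.memLp_gradient (μ := volume.restrict (unitBall n))).toLp (gradient ψ)
    have hΨ : Ψ ∈ S := subset_closure ⟨ψ, hψ, MemLp.coeFn_toLp _⟩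
    have h := (Submodule.mem_orthogonal' _ _).1 (S.sub_starProjection_mem_orthogonal F) Ψ hΨ
    rw [L2.inner_def] at h
    rw [← h]
    refine integral_congr_ae ?_
    filter_upwards [Lp.coeFn_sub F P, hf.coeFn_toLp,
      (hψ.memLp_gradient (μ := volume.restrict (unitBall n))).coeFn_toLp] with y h1 h2 h3
    rw [h1, Pi.sub_apply, h2, h3]

lemma IsW012.integral_inner_eq_zero {p : Rn n → Rn n}
    (hp : MemLp p 2 (volume.restrict (unitBall n)))
    (h : ∀ ψ, IsTestFunction (unitBall n) ψ → ∫ y in unitBall n, inner ℝ (p y) (gradient ψ y) = 0)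
    {φ : Rn n → ℝ} {Dφ : Rn n → Rn n} (hφ : IsW012 (unitBall n) φ Dφ) :
    ∫ y in unitBall n, inner ℝ (p y) (Dφ y) = 0 := by
  obtain ⟨ψ, hψ, -, h2⟩ := hφ.approx
  have := tendsto_integral_inner_of_tendsto_eLpNorm hp hφ.isW12.memLp_grad
    (fun k => (hψ k).memLp_gradient) h2
  refine tendsto_nhds_unique this ?_
  simp_rw [h _ (hψ _)]
  exact tendsto_const_nhds

/-- The reproducing operator annihilates the vector fields that are orthogonal to gradients,
because `G(x, ·)` is a limit of functions of `W₀^{1,2}(B₁)`. -/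
lemma greenPot_ae_eq_zero (hn : 3 ≤ n) {p : Rn n → Rn n}
    (hp : MemLp p 2 (volume.restrict (unitBall n)))
    (h : ∀ φ Dφ, IsW012 (unitBall n) φ Dφ → ∫ y in unitBall n, inner ℝ (p y) (Dφ y) = 0) :
    ∀ᵐ x ∂(volume.restrict (unitBall n)), greenPot p x = 0 := by
  filter_upwards [ae_rieszPot_ne_top hn hp, ae_restrict_mem (measurableSet_unitBall n)] with x h1 hx
  refine tendsto_nhds_unique
    (tendsto_integral_inner_greenGrad hn (norm_le_one_of_mem hx) hp.1 h1) ?_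
  refine tendsto_const_nhds.congr' ?_
  filter_upwards [self_mem_nhdsWithin] with t ht
  rw [← h _ _ (isW012_green hn ht x)]
  simp_rw [real_inner_comm]

/-- The solution of `-Δu = -div f` with zero boundary values for an `L²` vector field `f`, given by
the Green function. -/
lemma exists_isW012_greenPot (hn : 3 ≤ n) {f : Rn n → Rn n}
    (hf : MemLp f 2 (volume.restrict (unitBall n))) :
    ∃ D : Rn n → Rn n, IsW012 (unitBall n) (greenPot f) D ∧
      eLpNorm D 2 (volume.restrict (unitBall n)) ≤ eLpNorm f 2 (volume.restrict (unitBall n)) ∧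
      ∀ φ Dφ, IsW012 (unitBall n) φ Dφ →
        ∫ y in unitBall n, inner ℝ (D y) (Dφ y) = ∫ y in unitBall n, inner ℝ (f y) (Dφ y) := by
  obtain ⟨D, φ, hD, hφ, hlim, hle, hort⟩ := exists_projection hf
  have hz : ∀ φ Dφ, IsW012 (unitBall n) φ Dφ →
      ∫ y in unitBall n, inner ℝ (f y - D y) (Dφ y) = 0 := fun φ Dφ hφ =>
    hφ.integral_inner_eq_zero (hf.sub hD) hort
  refine ⟨D, (isW012_greenPot_of_tendsto hn hD hφ hlim).congr_ae ?_, hle, fun φ Dφ hφ => ?_⟩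
  · filter_upwards [greenPot_ae_eq_zero hn (hf.sub hD) hz, greenPot_sub_ae hn hf hD] with x h1 h2
    have h3 : greenPot f x - greenPot D x = 0 := h2.symm.trans h1
    linarith
  · have h1 := hz φ Dφ hφ
    simp_rw [inner_sub_left] at h1
    rw [integral_sub (integrable_inner_of_memLp hf hφ.isW12.memLp_grad)
      (integrable_inner_of_memLp hD hφ.isW12.memLp_grad)] at h1
    linarith

/-! ### Kato class functions as divergences of `L²` fields -/

lemma lintegral_riesz_mul_le_katoNorm {F : Type*} [NormedAddCommGroup F] {α β : ℝ}
    (hβ : (n : ℝ) - α = β) {V : Rn n → F} {x : Rn n} (hx : x ∈ unitBall n) :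
    ∫⁻ y in unitBall n, riesz β x y * ‖V y‖ₑ ≤ katoNorm α (unitBall n) V := by
  refine le_trans (le_of_eq (lintegral_congr fun y => ?_))
    (le_iSup₂ (f := fun x (_ : x ∈ unitBall n) =>
      ∫⁻ y in unitBall n, ‖V y‖ₑ / ‖x - y‖ₑ ^ ((n : ℝ) - α)) x hx)
  rw [riesz, hβ, div_eq_mul_inv, mul_comm]

lemma MemKato.setLIntegral_riesz_mul_le {F : Type*} [NormedAddCommGroup F] {α β : ℝ}
    (hβ : (n : ℝ) - α = β) {η : ℝ → ℝ≥0} {V : Rn n → F} (hV : MemKato α η (unitBall n) V)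
    {r : ℝ} (hr : 0 < r) {x : Rn n} (hx : x ∈ unitBall n) :
    ∫⁻ y in unitBall n ∩ Metric.ball x r, riesz β x y * ‖V y‖ₑ ≤ η r := by
  refine le_trans ?_ (hV.bound r hr)
  refine le_trans (le_of_eq (lintegral_congr fun y => ?_))
    (le_iSup₂ (f := fun x (_ : x ∈ unitBall n) =>
      ∫⁻ y in unitBall n ∩ Metric.ball x r, ‖V y‖ₑ / ‖x - y‖ₑ ^ ((n : ℝ) - α)) x hx)
  rw [riesz, hβ, div_eq_mul_inv, mul_comm]

lemma MemKato.katoNorm_ne_top {F : Type*} [NormedAddCommGroup F] {α : ℝ} {η : ℝ → ℝ≥0}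
    {V : Rn n → F} (hV : MemKato α η (unitBall n) V) : katoNorm α (unitBall n) V ≠ ⊤ := by
  refine ne_top_of_le_ne_top (ENNReal.coe_ne_top (r := η 2)) ?_
  refine le_trans (iSup₂_mono fun x hx => le_of_eq ?_) (hV.bound 2 two_pos)
  have : unitBall n ∩ Metric.ball x 2 = unitBall n := by
    refine inter_eq_left.2 fun y hy => ?_
    rw [mem_ball_iff_norm]
    have := norm_sub_le y x
    have := mem_unitBall.1 hx
    have := mem_unitBall.1 hy
    linarith
  rw [this]

/-- The Kato norm controls the `L¹` norm: take the pole at the centre of the ball. -/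
lemma lintegral_enorm_le_katoNorm {F : Type*} [NormedAddCommGroup F] {α : ℝ} (hα : α ≤ n)
    (V : Rn n → F) : ∫⁻ y in unitBall n, ‖V y‖ₑ ≤ katoNorm α (unitBall n) V := by
  refine le_trans ?_ (lintegral_riesz_mul_le_katoNorm (β := (n : ℝ) - α) rfl
    (mem_unitBall.2 (by simp : ‖(0 : Rn n)‖ < 1)))
  refine setLIntegral_mono' (measurableSet_unitBall n) fun y hy => ?_
  refine le_mul_of_one_le_left' ?_
  rw [riesz, ENNReal.one_le_inv, zero_sub, enorm_neg]
  refine ENNReal.rpow_le_one ?_ (by linarith)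
  rw [← ofReal_norm]
  simpa using ENNReal.ofReal_le_ofReal (norm_le_one_of_mem hy)

/-- The field `F(y) = ∫_{B₁} g(z) ∇_y G(z, y) dz`, for which `-div F = g` in the sense of
`W₀^{1,2}(B₁)`. -/
def dualField (g : Rn n → ℝ) (y : Rn n) : Rn n := ∫ z in unitBall n, g z • greenGrad 0 z y

lemma enorm_smul_greenGrad_le (hn : 3 ≤ n) (g : Rn n → ℝ) {y z : Rn n} (hy : y ∈ unitBall n)
    (hz : z ∈ unitBall n) : ‖g z • greenGrad 0 z y‖ₑ ≤
      kernelConst n * (riesz ((n : ℝ) - 1) y z * ‖g z‖ₑ) := by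
  rw [enorm_smul, mul_comm, ← mul_assoc, riesz_comm]
  exact mul_le_mul_left (enorm_greenGrad_le hn le_rfl (norm_le_one_of_mem hz)
    (norm_le_one_of_mem hy)) _

lemma lintegral_enorm_smul_greenGrad_le (hn : 3 ≤ n) {g : Rn n → ℝ}
    (hg : AEStronglyMeasurable g (volume.restrict (unitBall n))) {y : Rn n}
    (hy : y ∈ unitBall n) : ∫⁻ z in unitBall n, ‖g z • greenGrad 0 z y‖ₑ ≤
      kernelConst n * rieszPot (fun z => ‖g z‖ₑ) y := by
  rw [rieszPot, ← lintegral_const_mul'' _ (aemeasurable_riesz_mul_right _ y hg.enorm)]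
  exact setLIntegral_mono' (measurableSet_unitBall n) fun z hz => enorm_smul_greenGrad_le hn g hy hz

lemma aestronglyMeasurable_smul_greenGrad {g : Rn n → ℝ}
    (hg : AEStronglyMeasurable g (volume.restrict (unitBall n))) :
    AEStronglyMeasurable (fun q : Rn n × Rn n => g q.1 • greenGrad 0 q.1 q.2)
      ((volume.restrict (unitBall n)).prod (volume.restrict (unitBall n))) :=
  hg.comp_fst.smul (measurable_greenGrad 0).aestronglyMeasurable

lemma exists_lintegral_rieszPot_sq_le_katoNorm (hn : 3 ≤ n) :
    ∃ A : ℝ≥0, ∀ g : Rn n → ℝ, AEStronglyMeasurable g (volume.restrict (unitBall n)) →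
      ∫⁻ x in unitBall n, rieszPot (fun y => ‖g y‖ₑ) x ^ 2 ≤
        A * katoNorm 2 (unitBall n) g ^ 2 := by
  have hn' : (3 : ℝ) ≤ n := by exact_mod_cast hn
  obtain ⟨A, hA⟩ := exists_lintegral_rieszPot_sq_le_mul hn
  refine ⟨A, fun g hg => (hA _ _ hg.enorm fun x hx =>
    lintegral_riesz_mul_le_katoNorm rfl hx).trans ?_⟩
  rw [sq, ← mul_assoc]
  gcongr
  exact lintegral_enorm_le_katoNorm (by linarith) g

lemma exists_eLpNorm_dualField_le (hn : 3 ≤ n) :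
    ∃ C : ℝ≥0, ∀ g : Rn n → ℝ, AEStronglyMeasurable g (volume.restrict (unitBall n)) →
      eLpNorm (dualField g) 2 (volume.restrict (unitBall n)) ≤
        C * katoNorm 2 (unitBall n) g := by
  obtain ⟨A, hA⟩ := exists_lintegral_rieszPot_sq_le_katoNorm hn
  refine ⟨kernelConst n * NNReal.sqrt A, fun g hg => eLpNorm_two_le ?_⟩
  calc ∫⁻ y in unitBall n, ‖dualField g y‖ₑ ^ 2
      ≤ ∫⁻ y in unitBall n, (kernelConst n : ℝ≥0∞) ^ 2 * rieszPot (fun z => ‖g z‖ₑ) y ^ 2 := by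
        refine setLIntegral_mono' (measurableSet_unitBall n) fun y hy => ?_
        rw [← mul_pow]
        exact pow_le_pow_left' ((enorm_integral_le_lintegral_enorm _).trans
          (lintegral_enorm_smul_greenGrad_le hn hg hy)) 2
    _ = (kernelConst n : ℝ≥0∞) ^ 2 * ∫⁻ x in unitBall n, rieszPot (fun y => ‖g y‖ₑ) x ^ 2 :=
        lintegral_const_mul'' _ ((aemeasurable_rieszPot hg.enorm).pow_const 2)
    _ ≤ (kernelConst n : ℝ≥0∞) ^ 2 * (A * katoNorm 2 (unitBall n) g ^ 2) := by
        gcongr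
        exact hA _ hg
    _ = _ := by
        rw [mul_pow, ENNReal.coe_mul, mul_pow, ← ENNReal.coe_pow (NNReal.sqrt A),
          NNReal.sq_sqrt, mul_assoc]

lemma memLp_dualField (hn : 3 ≤ n) {g : Rn n → ℝ}
    (hg : AEStronglyMeasurable g (volume.restrict (unitBall n)))
    (hK : katoNorm 2 (unitBall n) g ≠ ⊤) :
    MemLp (dualField g) 2 (volume.restrict (unitBall n)) := by
  obtain ⟨C, hC⟩ := exists_eLpNorm_dualField_le hn
  exact ⟨(aestronglyMeasurable_smul_greenGrad hg).prod_swap.integral_prod_right',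
    (hC g hg).trans_lt (ENNReal.mul_lt_top ENNReal.coe_lt_top hK.lt_top)⟩

lemma integrable_prod_mul_inner_greenGrad (hn : 3 ≤ n) {g : Rn n → ℝ}
    (hg : AEStronglyMeasurable g (volume.restrict (unitBall n)))
    (hK : katoNorm 2 (unitBall n) g ≠ ⊤) {D : Rn n → Rn n}
    (hD : MemLp D 2 (volume.restrict (unitBall n))) :
    Integrable (fun q : Rn n × Rn n => inner ℝ (g q.1 • greenGrad 0 q.1 q.2) (D q.2))
      ((volume.restrict (unitBall n)).prod (volume.restrict (unitBall n))) := by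
  obtain ⟨A, hA⟩ := exists_lintegral_rieszPot_sq_le_katoNorm hn
  have hm := (aestronglyMeasurable_smul_greenGrad hg).inner (𝕜 := ℝ) hD.1.comp_snd
  refine ⟨hm, ?_⟩
  have hR := aemeasurable_rieszPot hg.enorm
  have hH := ENNReal.lintegral_mul_le_Lp_mul_Lq (volume.restrict (unitBall n))
    Real.HolderConjugate.two_two hR hD.1.enorm
  have h1 : ∫⁻ y in unitBall n, rieszPot (fun z => ‖g z‖ₑ) y * ‖D y‖ₑ ≠ ⊤ := by
    refine ne_top_of_le_ne_top (ENNReal.mul_ne_top (ENNReal.rpow_ne_top_of_nonneg (by norm_num) ?_)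
      (ENNReal.rpow_ne_top_of_nonneg (by norm_num) ?_)) hH
    · simp_rw [ENNReal.rpow_two]
      exact ne_top_of_le_ne_top (ENNReal.mul_ne_top ENNReal.coe_ne_top (ENNReal.pow_ne_top hK))
        (hA g hg)
    · simp_rw [ENNReal.rpow_two]
      rw [← eLpNorm_two_sq]
      exact ENNReal.pow_ne_top hD.2.ne
  rw [hasFiniteIntegral_iff_enorm, lintegral_prod_symm _ hm.enorm]
  refine lt_of_le_of_lt ?_ (ENNReal.mul_lt_top (ENNReal.coe_lt_top (r := kernelConst n)) h1.lt_top)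
  have hRD : AEMeasurable (fun y => rieszPot (fun z => ‖g z‖ₑ) y * ‖D y‖ₑ)
    (volume.restrict (unitBall n)) := hR.mul hD.1.enorm
  rw [← lintegral_const_mul'' _ hRD]
  refine setLIntegral_mono' (measurableSet_unitBall n) fun y hy => ?_
  calc ∫⁻ z in unitBall n, ‖inner ℝ (g z • greenGrad 0 z y) (D y)‖ₑ
      ≤ ∫⁻ z in unitBall n, ‖g z • greenGrad 0 z y‖ₑ * ‖D y‖ₑ := by
        refine lintegral_mono fun z => ?_
        rw [← ofReal_norm, ← ofReal_norm, ← ofReal_norm, ← ENNReal.ofReal_mul (norm_nonneg _)]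
        exact ENNReal.ofReal_le_ofReal (norm_inner_le_norm _ _)
    _ = (∫⁻ z in unitBall n, ‖g z • greenGrad 0 z y‖ₑ) * ‖D y‖ₑ :=
        lintegral_mul_const' _ _ enorm_ne_top
    _ ≤ _ := by
        rw [← mul_assoc]
        gcongr
        exact lintegral_enorm_smul_greenGrad_le hn hg hy

lemma ae_integrable_smul_greenGrad (hn : 3 ≤ n) {g : Rn n → ℝ}
    (hg : AEStronglyMeasurable g (volume.restrict (unitBall n)))
    (hK : katoNorm 2 (unitBall n) g ≠ ⊤) :
    ∀ᵐ y ∂(volume.restrict (unitBall n)),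
      IntegrableOn (fun z => g z • greenGrad 0 z y) (unitBall n) := by
  obtain ⟨A, hA⟩ := exists_lintegral_rieszPot_sq_le_katoNorm hn
  have h := ne_top_of_le_ne_top (ENNReal.mul_ne_top (ENNReal.coe_ne_top (r := A))
    (ENNReal.pow_ne_top (n := 2) hK)) (hA g hg)
  filter_upwards [ae_lt_top' ((aemeasurable_rieszPot hg.enorm).pow_const 2) h,
    ae_restrict_mem (measurableSet_unitBall n)] with y h1 hy
  refine ⟨hg.smul ((measurable_greenGrad 0).comp
    (measurable_id.prodMk measurable_const)).aestronglyMeasurable,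
    (lintegral_enorm_smul_greenGrad_le hn hg hy).trans_lt
      (ENNReal.mul_lt_top ENNReal.coe_lt_top ?_)⟩
  rw [lt_top_iff_ne_top]
  intro h2
  simp [h2] at h1

/-- A Kato class function acts on `W₀^{1,2}(B₁)` as the divergence of its dual field. -/
lemma IsW012.integrable_mul_and_integral_eq (hn : 3 ≤ n) {g : Rn n → ℝ}
    (hg : AEStronglyMeasurable g (volume.restrict (unitBall n)))
    (hK : katoNorm 2 (unitBall n) g ≠ ⊤) {φ : Rn n → ℝ} {Dφ : Rn n → Rn n}
    (hφ : IsW012 (unitBall n) φ Dφ) :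
    IntegrableOn (fun y => g y * φ y) (unitBall n) ∧
      ∫ y in unitBall n, g y * φ y = ∫ y in unitBall n, inner ℝ (dualField g y) (Dφ y) := by
  have hI := integrable_prod_mul_inner_greenGrad hn hg hK hφ.isW12.memLp_grad
  have h1 : (fun z => ∫ y in unitBall n, inner ℝ (g z • greenGrad 0 z y) (Dφ y)) =ᵐ[
      volume.restrict (unitBall n)] fun z => g z * φ z := by
    filter_upwards [hφ.ae_eq_greenPot hn] with z hz
    simp_rw [real_inner_smul_left]
    rw [integral_const_mul, hz, greenPot]
  have h2 : (fun y => ∫ z in unitBall n, inner ℝ (g z • greenGrad 0 z y) (Dφ y)) =ᵐ[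
      volume.restrict (unitBall n)] fun y => inner ℝ (dualField g y) (Dφ y) := by
    filter_upwards [ae_integrable_smul_greenGrad hn hg hK] with y hy
    rw [dualField, real_inner_comm, ← integral_inner hy]
    simp_rw [real_inner_comm]
  refine ⟨hI.integral_prod_left.congr h1, ?_⟩
  rw [← integral_congr_ae h1, ← integral_congr_ae h2]
  exact integral_integral_swap hI

/-- The reproducing operator maps the dual field of `g` to the Green potential of `g`. -/
lemma greenPot_dualField_ae (hn : 3 ≤ n) {g : Rn n → ℝ}
    (hg : AEStronglyMeasurable g (volume.restrict (unitBall n)))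
    (hK : katoNorm 2 (unitBall n) g ≠ ⊤) :
    ∀ᵐ x ∂(volume.restrict (unitBall n)),
      greenPot (dualField g) x = ∫ y in unitBall n, green 0 x y * g y := by
  have hF := memLp_dualField hn hg hK
  filter_upwards [ae_rieszPot_ne_top hn hF, ae_restrict_mem (measurableSet_unitBall n)] with x h1 hx
  have hx' := norm_le_one_of_mem hx
  have t1 := tendsto_integral_inner_greenGrad hn hx' hF.1 h1
  have t2 := tendsto_integral_green_mul hn hx' hg
    (ne_top_of_le_ne_top hK (lintegral_riesz_mul_le_katoNorm rfl hx))
  refine tendsto_nhds_unique t1 (t2.congr' ?_)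
  filter_upwards [self_mem_nhdsWithin] with t ht
  have h3 := ((isW012_green hn ht x).integrable_mul_and_integral_eq hn hg hK).2
  simp_rw [mul_comm, real_inner_comm] at h3 ⊢
  exact h3

/-! ### Continuity of the potentials up to the boundary -/

/-- A continuous cutoff of the diagonal: it vanishes for `|x - y| ≤ r / 2` and equals `1` for
`|x - y| ≥ r`. -/
def offDiag (r : ℝ) (x y : Rn n) : ℝ := max 0 (min 1 (2 * ‖x - y‖ / r - 1))

lemma offDiag_nonneg (r : ℝ) (x y : Rn n) : 0 ≤ offDiag r x y := le_max_left _ _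

lemma offDiag_le_one (r : ℝ) (x y : Rn n) : offDiag r x y ≤ 1 :=
  max_le zero_le_one (min_le_left _ _)

lemma offDiag_eq_zero {r : ℝ} (hr : 0 < r) {x y : Rn n} (h : ‖x - y‖ ≤ r / 2) :
    offDiag r x y = 0 := by
  refine max_eq_left (min_le_of_right_le ?_)
  rw [sub_nonpos, div_le_one hr]; linarith

lemma offDiag_eq_one {r : ℝ} (hr : 0 < r) {x y : Rn n} (h : r ≤ ‖x - y‖) :
    offDiag r x y = 1 := by
  have : (1 : ℝ) ≤ 2 * ‖x - y‖ / r - 1 := by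
    rw [le_sub_iff_add_le, le_div_iff₀ hr]; linarith
  rw [offDiag, min_eq_left this, max_eq_right zero_le_one]

lemma continuous_offDiag_left (r : ℝ) (y : Rn n) : Continuous fun x => offDiag r x y := by
  unfold offDiag; fun_prop

lemma continuous_offDiag_right (r : ℝ) (x : Rn n) : Continuous (offDiag r x) := by
  unfold offDiag; fun_prop

/-- A potential whose kernel is bounded by a Riesz kernel, continuous off the diagonal and zero for
poles on the sphere, is continuous up to the boundary if the density satisfies a uniform Kato
condition: it is the uniform limit of the potentials with kernels cut off near the diagonal. -/
lemma continuousOn_integral_of_kato {β : ℝ} (hβ : 0 ≤ β) {T : Rn n → Rn n → ℝ}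
    {q : Rn n → ℝ≥0∞} {K : ℝ≥0} {η : ℝ → ℝ≥0} (hη : Tendsto η (𝓝[>] 0) (𝓝 0))
    (hq : AEMeasurable q (volume.restrict (unitBall n)))
    (hqt : ∫⁻ y in unitBall n, q y ≠ ⊤)
    (hT : ∀ x, AEStronglyMeasurable (T x) (volume.restrict (unitBall n)))
    (hle : ∀ x y, ‖x‖ ≤ 1 → y ∈ unitBall n → ‖T x y‖ₑ ≤ K * (riesz β x y * q y))
    (hcont : ∀ x y, ‖x‖ ≤ 1 → y ∈ unitBall n → y ≠ x → ContinuousAt (fun z => T z y) x)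
    (hzero : ∀ x y, ‖x‖ = 1 → T x y = 0)
    (hint : ∀ x ∈ unitBall n, IntegrableOn (T x) (unitBall n))
    (hkato : ∀ r, 0 < r → ∀ x ∈ unitBall n,
      ∫⁻ y in unitBall n ∩ Metric.ball x r, riesz β x y * q y ≤ η r) :
    ContinuousOn (fun x => ∫ y in unitBall n, T x y) (closure (unitBall n)) := by
  have hclosure {x : Rn n} (hx : x ∈ closure (unitBall n)) : ‖x‖ ≤ 1 := mem_closure_unitBall.1 hx
  have hmeas (r : ℝ) (x : Rn n) : AEStronglyMeasurable (fun y => offDiag r x y * T x y)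
      (volume.restrict (unitBall n)) :=
    (continuous_offDiag_right r x).aestronglyMeasurable.mul (hT x)
  -- the cut off potentials are continuous by dominated convergence
  have hU (r : ℝ) (hr : 0 < r) :
      ContinuousOn (fun x => ∫ y in unitBall n, offDiag r x y * T x y)
        (closure (unitBall n)) := by
    set c : ℝ≥0∞ := K * (ENNReal.ofReal (r / 2) ^ β)⁻¹
    have hc : c ≠ ⊤ := by
      refine ENNReal.mul_ne_top ENNReal.coe_ne_top (ENNReal.inv_ne_top.2 ?_)
      rw [ENNReal.ofReal_rpow_of_pos (by positivity)]
      have : 0 < (r / 2) ^ β := by positivity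
      simpa using this
    have hbt : ∫⁻ y in unitBall n, c * q y ≠ ⊤ := by
      rw [lintegral_const_mul'' _ hq]
      exact ENNReal.mul_ne_top hc hqt
    have hb := integrable_toReal_of_lintegral_ne_top (hq.const_mul c) hbt
    refine continuousOn_of_dominated (bound := fun y => (c * q y).toReal)
      (fun x _ => hmeas r x) (fun x hx => ?_) hb ?_
    · filter_upwards [ae_lt_top' (hq.const_mul c) hbt,
        ae_restrict_mem (measurableSet_unitBall n)] with y hyt hy
      by_cases hxy : ‖x - y‖ ≤ r / 2
      · rw [offDiag_eq_zero hr hxy, zero_mul, norm_zero]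
        exact ENNReal.toReal_nonneg
      · rw [← toReal_enorm]
        refine ENNReal.toReal_mono hyt.ne ?_
        rw [enorm_mul]
        have h1 : ‖offDiag r x y‖ₑ ≤ 1 := by
          rw [← ofReal_norm, Real.norm_of_nonneg (offDiag_nonneg _ _ _)]
          simpa using ENNReal.ofReal_le_ofReal (offDiag_le_one r x y)
        refine (mul_le_of_le_one_left' h1).trans ((hle x y (hclosure hx) hy).trans ?_)
        rw [← mul_assoc]
        refine mul_le_mul_left (mul_le_mul_right ?_ _) _
        rw [riesz, ENNReal.inv_le_inv, ← ofReal_norm]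
        exact ENNReal.rpow_le_rpow (ENNReal.ofReal_le_ofReal (le_of_lt (not_le.1 hxy))) hβ
    · filter_upwards [ae_restrict_mem (measurableSet_unitBall n)] with y hy
      intro x hx
      refine ContinuousAt.continuousWithinAt ?_
      by_cases hxy : y = x
      · have : (fun z => offDiag r z y * T z y) =ᶠ[𝓝 x] fun _ => 0 := by
          have hd : Continuous fun z : Rn n => ‖z - y‖ := by fun_prop
          have h0 : ‖x - y‖ < r / 2 := by rw [hxy, sub_self, norm_zero]; positivity
          filter_upwards [(isOpen_lt hd continuous_const).mem_nhds h0] with z hz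
          rw [offDiag_eq_zero hr (le_of_lt hz), zero_mul]
        exact continuousAt_const.congr this.symm
      · exact (continuous_offDiag_left r y).continuousAt.mul (hcont x y (hclosure hx) hy hxy)
  -- the error of the cutoff is controlled by the Kato modulus
  have herr (r : ℝ) (hr : 0 < r) (x : Rn n) (hx : x ∈ closure (unitBall n)) :
      ‖(∫ y in unitBall n, T x y) - ∫ y in unitBall n, offDiag r x y * T x y‖ₑ ≤ K * η r := by
    rcases (hclosure hx).lt_or_eq with h1 | h1
    · have hxB := mem_unitBall.2 h1
      have hI := hint x hxB
      have hI2 : IntegrableOn (fun y => offDiag r x y * T x y) (unitBall n) := by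
        refine hI.norm.mono' (hmeas r x) (Eventually.of_forall fun y => ?_)
        rw [norm_mul, Real.norm_of_nonneg (offDiag_nonneg _ _ _)]
        exact mul_le_of_le_one_left (norm_nonneg _) (offDiag_le_one _ _ _)
      rw [← integral_sub hI hI2]
      refine (enorm_integral_le_lintegral_enorm _).trans ?_
      calc ∫⁻ y in unitBall n, ‖T x y - offDiag r x y * T x y‖ₑ
          ≤ ∫⁻ y in unitBall n,
              (Metric.ball x r).indicator (fun y => K * (riesz β x y * q y)) y := by
            refine setLIntegral_mono' (measurableSet_unitBall n) fun y hy => ?_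
            by_cases hxy : y ∈ Metric.ball x r
            · rw [indicator_of_mem hxy]
              refine le_trans ?_ (hle x y h1.le hy)
              rw [← ofReal_norm, ← ofReal_norm]
              refine ENNReal.ofReal_le_ofReal ?_
              rw [← one_sub_mul, norm_mul,
                Real.norm_of_nonneg (sub_nonneg.2 (offDiag_le_one _ _ _))]
              exact mul_le_of_le_one_left (norm_nonneg _) (by linarith [offDiag_nonneg r x y])
            · rw [indicator_of_notMem hxy]
              rw [mem_ball_iff_norm, not_lt, norm_sub_rev] at hxy
              rw [offDiag_eq_one hr hxy, one_mul, sub_self, enorm_zero]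
        _ = K * ∫⁻ y in unitBall n ∩ Metric.ball x r, riesz β x y * q y := by
            rw [lintegral_indicator measurableSet_ball, Measure.restrict_restrict measurableSet_ball,
              inter_comm, lintegral_const_mul'' _ ]
            exact (aemeasurable_riesz_mul_right β x hq).mono_measure
              (Measure.restrict_mono inter_subset_left le_rfl)
        _ ≤ K * η r := by gcongr; exact hkato r hr x hxB
    · have h2 (y : Rn n) : T x y = 0 := hzero x y h1
      simp [h2]
  refine continuousOn_of_uniform_approx_of_continuousOn fun u hu => ?_
  obtain ⟨ε, hε, hεu⟩ := Metric.mem_uniformity_dist.1 hu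
  have hlim : Tendsto (fun r => K * η r) (𝓝[>] 0) (𝓝 0) := by
    simpa using hη.const_mul K
  have hε' : (0 : ℝ≥0) < ε.toNNReal := Real.toNNReal_pos.2 hε
  obtain ⟨r, hr1, hr0⟩ := ((hlim.eventually (gt_mem_nhds hε')).and self_mem_nhdsWithin).exists
  refine ⟨_, hU r hr0, fun x hx => hεu ?_⟩
  rw [dist_eq_norm, ← toReal_enorm]
  refine lt_of_le_of_lt (ENNReal.toReal_mono (by finiteness) (herr r hr0 x hx)) ?_
  rw [← ENNReal.coe_mul, ENNReal.coe_toReal]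
  exact (Real.lt_toNNReal_iff_coe_lt).1 hr1

lemma continuousOn_greenPot (hn : 3 ≤ n) {η : ℝ → ℝ≥0} {f : Rn n → Rn n}
    (hf : MemKato 1 η (unitBall n) f) : ContinuousOn (greenPot f) (closure (unitBall n)) := by
  have hn' : (3 : ℝ) ≤ n := by exact_mod_cast hn
  refine continuousOn_integral_of_kato (β := (n : ℝ) - 1) (q := fun y => ‖f y‖ₑ)
    (K := kernelConst n) (by linarith) hf.tendsto_modulus hf.aestronglyMeasurable.enorm ?_
    (fun x => aestronglyMeasurable_inner_greenGrad 0 x hf.aestronglyMeasurable)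
    (fun x y hx hy => enorm_inner_greenGrad_le hn le_rfl hx (norm_le_one_of_mem hy) _)
    (fun x y hx hy hxy => ?_)
    (fun x y hx => by rw [greenGrad_eq_zero_left hx, inner_zero_left])
    (fun x hx => ?_)
    (fun r hr x hx => hf.setLIntegral_riesz_mul_le rfl hr hx)
  · exact ne_top_of_le_ne_top hf.katoNorm_ne_top (lintegral_enorm_le_katoNorm (by linarith) f)
  · have := continuousAt_greenGrad le_rfl hx (norm_le_one_of_mem hy) hxy
    exact (ContinuousAt.comp (f := fun z : Rn n => ((0 : ℝ), z)) this (by fun_prop)).inner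
      (𝕜 := ℝ) continuousAt_const
  · exact integrableOn_inner_greenGrad hn le_rfl (norm_le_one_of_mem hx) hf.aestronglyMeasurable
      (ne_top_of_le_ne_top hf.katoNorm_ne_top (lintegral_riesz_mul_le_katoNorm rfl hx))

lemma continuousOn_integral_green_mul (hn : 3 ≤ n) {η : ℝ → ℝ≥0} {g : Rn n → ℝ}
    (hg : MemKato 2 η (unitBall n) g) :
    ContinuousOn (fun x => ∫ y in unitBall n, green 0 x y * g y) (closure (unitBall n)) := by
  have hn' : (3 : ℝ) ≤ n := by exact_mod_cast hn
  refine continuousOn_integral_of_kato (β := (n : ℝ) - 2) (q := fun y => ‖g y‖ₑ)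
    (K := kernelConst n) (by linarith) hg.tendsto_modulus hg.aestronglyMeasurable.enorm ?_
    (fun x => aestronglyMeasurable_green_mul 0 x hg.aestronglyMeasurable)
    (fun x y hx hy => enorm_green_mul_le hn le_rfl hx (norm_le_one_of_mem hy) _)
    (fun x y hx hy hxy => ?_)
    (fun x y hx => by rw [green_eq_zero_left hx, zero_mul])
    (fun x hx => ?_)
    (fun r hr x hx => hg.setLIntegral_riesz_mul_le rfl hr hx)
  · exact ne_top_of_le_ne_top hg.katoNorm_ne_top (lintegral_enorm_le_katoNorm (by linarith) g)
  · have := continuousAt_green le_rfl hx (norm_le_one_of_mem hy) hxy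
    exact (ContinuousAt.comp (f := fun z : Rn n => ((0 : ℝ), z)) this (by fun_prop)).mul
      continuousAt_const
  · exact integrableOn_green_mul hn le_rfl (norm_le_one_of_mem hx) hg.aestronglyMeasurable
      (ne_top_of_le_ne_top hg.katoNorm_ne_top (lintegral_riesz_mul_le_katoNorm rfl hx))

/-! ### The Dirichlet problem -/

/-- The solution of the Dirichlet problem given by the Green function. On the unit sphere the
kernels vanish identically, so that this formula also yields the boundary values. -/
def greenSolution (f : Rn n → Rn n) (g : Rn n → ℝ) (x : Rn n) : ℝ :=
  greenPot f x + ∫ y in unitBall n, green 0 x y * g y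

lemma greenSolution_eq_zero (f : Rn n → Rn n) (g : Rn n → ℝ) {x : Rn n} (hx : ‖x‖ = 1) :
    greenSolution f g x = 0 := by
  simp [greenSolution, greenPot, green_eq_zero_left hx, greenGrad_eq_zero_left hx]

lemma greenIntegrand_ae_eq (hn : 3 ≤ n) (f : Rn n → Rn n) (g : Rn n → ℝ) {x : Rn n}
    (hx : x ∈ unitBall n) :
    (fun y => inner ℝ (greenGrad 0 x y) (f y) + green 0 x y * g y) =ᵐ[
      volume.restrict (unitBall n)] fun y => greenIntegrand (green 0) f g x y := by
  filter_upwards [ae_ne_and_mem hn x] with y hy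
  rw [greenIntegrand, ← gradient_green_zero hn (mem_unitBall.1 hx) hy.2 hy.1]

lemma integrableOn_greenIntegrand_and_eq (hn : 3 ≤ n) {ηf ηg : ℝ → ℝ≥0} {f : Rn n → Rn n}
    {g : Rn n → ℝ} (hg : MemKato 2 ηg (unitBall n) g) (hf : MemKato 1 ηf (unitBall n) f)
    {x : Rn n} (hx : x ∈ unitBall n) :
    IntegrableOn (fun y => greenIntegrand (green 0) f g x y) (unitBall n) ∧
      greenSolution f g x = ∫ y in unitBall n, greenIntegrand (green 0) f g x y := by
  have hx' := norm_le_one_of_mem hx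
  have i1 := integrableOn_inner_greenGrad hn le_rfl hx' hf.aestronglyMeasurable
    (ne_top_of_le_ne_top hf.katoNorm_ne_top (lintegral_riesz_mul_le_katoNorm rfl hx))
  have i2 := integrableOn_green_mul hn le_rfl hx' hg.aestronglyMeasurable
    (ne_top_of_le_ne_top hg.katoNorm_ne_top (lintegral_riesz_mul_le_katoNorm rfl hx))
  have h := greenIntegrand_ae_eq hn f g hx
  exact ⟨(i1.add i2).congr h, by
    rw [← integral_congr_ae h, integral_add i1 i2, greenSolution, greenPot]⟩

lemma enorm_greenSolution_le (hn : 3 ≤ n) {ηf ηg : ℝ → ℝ≥0} {f : Rn n → Rn n}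
    {g : Rn n → ℝ} (hg : MemKato 2 ηg (unitBall n) g) (hf : MemKato 1 ηf (unitBall n) f)
    {x : Rn n} (hx : x ∈ unitBall n) :
    ‖greenSolution f g x‖ₑ ≤
      kernelConst n * (katoNorm 1 (unitBall n) f + katoNorm 2 (unitBall n) g) := by
  have hx' := norm_le_one_of_mem hx
  rw [mul_add]
  refine (enorm_add_le _ _).trans (add_le_add ?_ ?_)
  · refine (enorm_greenPot_le hn hf.aestronglyMeasurable hx').trans ?_
    gcongr
    exact lintegral_riesz_mul_le_katoNorm rfl hx
  · refine (enorm_integral_le_lintegral_enorm _).trans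
      ((lintegral_enorm_green_mul_le hn le_rfl hx' hg.aestronglyMeasurable).trans ?_)
    gcongr
    exact lintegral_riesz_mul_le_katoNorm rfl hx

/-- The Dirichlet solution is determined by its weak gradient, hence unique. -/
lemma IsDirichletSolution.eqOn (hn : 3 ≤ n) {f : Rn n → Rn n} {g : Rn n → ℝ} {u v : Rn n → ℝ}
    {Du Dv : Rn n → Rn n} (hu : IsDirichletSolution (unitBall n) f g u Du)
    (hv : IsDirichletSolution (unitBall n) f g v Dv) : EqOn v u (closure (unitBall n)) := by
  have hw := hv.isW012.sub hu.isW012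
  have hDu := hu.isW012.isW12.memLp_grad
  have hDv := hv.isW012.isW12.memLp_grad
  have h1 := (hv.isWeakSolution.weak_eq _ _ hw).trans (hu.isWeakSolution.weak_eq _ _ hw).symm
  have h2 : ∫ y in unitBall n, ‖Dv y - Du y‖ ^ 2 = 0 := by
    simp_rw [← real_inner_self_eq_norm_sq]
    rw [← sub_eq_zero.2 h1]
    simp_rw [fun y => inner_sub_left (𝕜 := ℝ) (Dv y) (Du y) (Dv y - Du y)]
    exact integral_sub (integrable_inner_of_memLp hDv (hDv.sub hDu))
      (integrable_inner_of_memLp hDu (hDv.sub hDu))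
  have h3 : Dv =ᵐ[volume.restrict (unitBall n)] Du := by
    have hi : Integrable (fun y => ‖Dv y - Du y‖ ^ 2) (volume.restrict (unitBall n)) := by
      simp_rw [← real_inner_self_eq_norm_sq]
      exact integrable_inner_of_memLp (hDv.sub hDu) (hDv.sub hDu)
    filter_upwards [(integral_eq_zero_iff_of_nonneg (fun y => by positivity) hi).1 h2] with y hy
    have : ‖Dv y - Du y‖ = 0 := pow_eq_zero_iff two_ne_zero |>.1 hy
    exact sub_eq_zero.1 (norm_eq_zero.1 this)
  have h4 : v =ᵐ[volume.restrict (unitBall n)] u := by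
    filter_upwards [hv.isW012.ae_eq_greenPot hn, hu.isW012.ae_eq_greenPot hn] with x hx1 hx2
    rw [hx1, hx2, greenPot_congr h3]
  have h5 : EqOn v u (unitBall n) :=
    Measure.eqOn_open_of_ae_eq h4 Metric.isOpen_ball (hv.continuousOn.mono subset_closure)
      (hu.continuousOn.mono subset_closure)
  exact h5.of_subset_closure hv.continuousOn hu.continuousOn subset_closure subset_rfl

/-- Existence for the Dirichlet problem: the Green potential is the solution, and the energy of its
gradient is controlled by the `L²` field `f` plus the dual field of `g`. -/
lemma exists_isDirichletSolution (hn : 3 ≤ n) {ηf ηg : ℝ → ℝ≥0} {f : Rn n → Rn n}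
    {g : Rn n → ℝ} (hg : MemKato 2 ηg (unitBall n) g) (hf : MemKato 1 ηf (unitBall n) f)
    (hf2 : MemLp f 2 (volume.restrict (unitBall n))) :
    ∃ Du : Rn n → Rn n, IsDirichletSolution (unitBall n) f g (greenSolution f g) Du ∧
      eLpNorm Du 2 (volume.restrict (unitBall n)) ≤
        eLpNorm f 2 (volume.restrict (unitBall n)) +
          eLpNorm (dualField g) 2 (volume.restrict (unitBall n)) := by
  have hgm := hg.aestronglyMeasurable
  have hK := hg.katoNorm_ne_top
  have hF := memLp_dualField hn hgm hK
  obtain ⟨D, hW, hle, hweak⟩ := exists_isW012_greenPot hn (hf2.add hF)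
  have hae : greenPot (f + dualField g) =ᵐ[volume.restrict (unitBall n)] greenSolution f g := by
    filter_upwards [ae_rieszPot_ne_top hn hf2, ae_rieszPot_ne_top hn hF,
      greenPot_dualField_ae hn hgm hK, ae_restrict_mem (measurableSet_unitBall n)] with x h1 h2 h3 hx
    have hx' := norm_le_one_of_mem hx
    rw [greenSolution, ← h3, greenPot, greenPot, greenPot,
      ← integral_add (integrableOn_inner_greenGrad hn le_rfl hx' hf2.1 h1)
        (integrableOn_inner_greenGrad hn le_rfl hx' hF.1 h2)]
    simp_rw [Pi.add_apply, inner_add_right]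
  have hu := hW.congr_ae hae
  refine ⟨D, ⟨hu, ?_, hu.isW12, fun φ Dφ hφ => ?_, fun φ Dφ hφ => ?_⟩,
    hle.trans (eLpNorm_add_le hf2.1 hF.1 one_le_two)⟩
  · exact (continuousOn_greenPot hn hf).add (continuousOn_integral_green_mul hn hg)
  · exact (integrable_inner_of_memLp hf2 hφ.isW12.memLp_grad).add
      (hφ.integrable_mul_and_integral_eq hn hgm hK).1
  · obtain ⟨h1, h2⟩ := hφ.integrable_mul_and_integral_eq hn hgm hK
    rw [hweak φ Dφ hφ, integral_add (integrable_inner_of_memLp hf2 hφ.isW12.memLp_grad) h1, h2,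
      ← integral_add (integrable_inner_of_memLp hf2 hφ.isW12.memLp_grad)
        (integrable_inner_of_memLp hF hφ.isW12.memLp_grad)]
    simp_rw [Pi.add_apply, inner_add_left]

end KatoDirichlet

end

theorem lemma5p8 (n : ℕ) (hn : 3 ≤ n) :
    ∃ G : KatoDirichlet.Rn n → KatoDirichlet.Rn n → ℝ,
      KatoDirichlet.IsGreenFunction (KatoDirichlet.unitBall n) G ∧
      ∃ C : ℝ≥0,
        ∀ (ηg ηf : ℝ → ℝ≥0) (g : KatoDirichlet.Rn n → ℝ)
          (f : KatoDirichlet.Rn n → KatoDirichlet.Rn n),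
          KatoDirichlet.MemKato 2 ηg (KatoDirichlet.unitBall n) g →
          KatoDirichlet.MemKato 1 ηf (KatoDirichlet.unitBall n) f →
          MemLp f 2 (volume.restrict (KatoDirichlet.unitBall n)) →
          ∃ (u : KatoDirichlet.Rn n → ℝ) (Du : KatoDirichlet.Rn n → KatoDirichlet.Rn n),
            -- existence in `W_0^{1,2} ∩ C(closure B₁)`
            KatoDirichlet.IsDirichletSolution (KatoDirichlet.unitBall n) f g u Du ∧
            -- uniqueness
            (∀ (v : KatoDirichlet.Rn n → ℝ) (Dv : KatoDirichlet.Rn n → KatoDirichlet.Rn n),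
              KatoDirichlet.IsDirichletSolution (KatoDirichlet.unitBall n) f g v Dv →
                EqOn v u (closure (KatoDirichlet.unitBall n))) ∧
            -- Green representation
            (∀ x ∈ KatoDirichlet.unitBall n,
              IntegrableOn (fun y => KatoDirichlet.greenIntegrand G f g x y)
                (KatoDirichlet.unitBall n) ∧
              u x = ∫ y in KatoDirichlet.unitBall n,
                KatoDirichlet.greenIntegrand G f g x y) ∧
            (∀ x ∈ frontier (KatoDirichlet.unitBall n), u x = 0) ∧
            -- the estimate
            eLpNorm u ⊤ (volume.restrict (KatoDirichlet.unitBall n)) +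
                eLpNorm Du 2 (volume.restrict (KatoDirichlet.unitBall n)) ≤
              C * (eLpNorm f 2 (volume.restrict (KatoDirichlet.unitBall n)) +
                eLpNorm g 1 (volume.restrict (KatoDirichlet.unitBall n)) +
                KatoDirichlet.katoNorm 1 (KatoDirichlet.unitBall n) f +
                KatoDirichlet.katoNorm 2 (KatoDirichlet.unitBall n) g) := by
  obtain ⟨C, hC⟩ := KatoDirichlet.exists_eLpNorm_dualField_le hn
  refine ⟨KatoDirichlet.green 0, KatoDirichlet.isGreenFunction_green,
    KatoDirichlet.kernelConst n + 1 + C, fun ηg ηf g f hg hf hf2 => ?_⟩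
  obtain ⟨Du, hsol, hDu⟩ := KatoDirichlet.exists_isDirichletSolution hn hg hf hf2
  refine ⟨KatoDirichlet.greenSolution f g, Du, hsol, fun v Dv hv => hsol.eqOn hn hv,
    fun x hx => KatoDirichlet.integrableOn_greenIntegrand_and_eq hn hg hf hx,
    fun x hx => KatoDirichlet.greenSolution_eq_zero f g (KatoDirichlet.mem_frontier_unitBall.1 hx),
    ?_⟩
  have h1 : eLpNorm (KatoDirichlet.greenSolution f g) ⊤
      (volume.restrict (KatoDirichlet.unitBall n)) ≤
        KatoDirichlet.kernelConst n * (KatoDirichlet.katoNorm 1 (KatoDirichlet.unitBall n) f +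
          KatoDirichlet.katoNorm 2 (KatoDirichlet.unitBall n) g) := by
    rw [eLpNorm_exponent_top]
    refine eLpNormEssSup_le_of_ae_enorm_bound ?_
    filter_upwards [ae_restrict_mem (KatoDirichlet.measurableSet_unitBall n)] with x hx
      using KatoDirichlet.enorm_greenSolution_le hn hg hf hx
  have h2 := hDu.trans (add_le_add_right (hC g hg.aestronglyMeasurable) _)
  generalize eLpNorm f 2 (volume.restrict (KatoDirichlet.unitBall n)) = a at *
  generalize eLpNorm g 1 (volume.restrict (KatoDirichlet.unitBall n)) = b
  generalize KatoDirichlet.katoNorm 1 (KatoDirichlet.unitBall n) f = c at *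
  generalize KatoDirichlet.katoNorm 2 (KatoDirichlet.unitBall n) g = d at *
  push_cast
  calc _ ≤ (KatoDirichlet.kernelConst n : ℝ≥0∞) * (c + d) + (1 * a + C * d) := by
        rw [one_mul]; exact add_le_add h1 h2
    _ ≤ KatoDirichlet.kernelConst n * (a + b + c + d) +
          (1 * (a + b + c + d) + C * (a + b + c + d)) := by
        gcongr
        · exact le_add_self
        · rw [add_assoc, add_assoc]; exact le_self_add
        · exact le_add_self
    _ = _ := by ring
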